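/- Let $n\ge 2$, let $S_n(1)=\{x\in\mathbb R^n: x\ge 0,\ \sum_i x_i=1\}$, and let $U$ and $\overline U$ be the open and closed Euclidean $\mu_0$-neighbourhoods of $S_n(1)$. Let $\eta$ be a random element and let $f(x;\eta)$, $x\in\overline U$, be integrable for every $x$. Put $f(x)=E_\eta[f(x;\eta)]$ and $f_*=\min_{x\in S_n(1)}f(x)$. Suppose that: 1. for almost every $\eta$ the function $x\mapsto f(x;\eta)$ is convex on $\overline U$ and differentiable on $U$; 2. $E_\eta[\nabla_x f(x;\eta)]=\nabla f(x)$ for all $x\in U$; 3. for almost every $\eta$, $|f(x;\eta)-f(y;\eta)|\le M_2(\eta)\|x-y\|_2$ for all $x,y\in\overline U$, where $0<M_2:=\sqrt{E[M_2(\eta)^2]}<\infty$; 4. for almost every $\eta$, $\|\nabla_x f(x;\eta)-\nabla_x f(y;\eta)\|_2\le L_2(\eta)\|x-y\|_2$ for all $x,y\in U$, where $0<L_2:=\sqrt{E[L_2(\eta)^2]}<\infty$. Let $\varepsilon>0$ and $$\mu=\min\left\{\max\left\{\frac{\varepsilon}{2M_2},\sqrt{\frac{\varepsilon}{L_2}}\right\},\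 \frac{M_2}{L_2}\sqrt{\frac1{6n}}\right\},\qquad \mu\le\mu_0,\qquad \delta\le\frac{M_2\,\mu}{\sqrt{96\,n}} .$$ At step $k=1,2,\dots$ a direction $e^k$, uniformly distributed on the Euclidean unit sphere of $\mathbb R^n$, and a realization $\eta^k$, distributed as $\eta$, are drawn, and a noisy oracle is queried at two points with the same realization; it returns $f(x^k+\mu e^k;\eta^k)+\xi^k$ and $f(x^k;\eta^k)+\xi_0^k$. Call the collection of all $(e^j,\eta^j,\xi^j,\xi_0^j)$ with $j<k$ the past of step $k$. The realization $\eta^k$ is independent of the past, the direction $e^k$ is independent of the pair (past, $\eta^k$), and the noises satisfy $|\xi^k|\le\delta$, $|\xi_0^k|\le\delta$ almost surely and do not depend on the direction, in the sense that $e^k$ is independent of (past, $\xi^k$) and of (past, $\xi_0^k$); the noises may depend on $\eta^k$. Put $$g^k=\frac n\mu\Big(f(x^k+\mu e^k;\eta^k)+\xi^k-\big(f(x^k;\eta^k)+\xi_0^k\big)\Big)e^k ,$$ and let the iterates be $x^1_i=1/n$ and, for $t\ge1$, $$x_i^{t+1}=\frac{\exp\left(-\frac1{\beta_{t+1}}\sum_{k=1}^t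 g^k_i\right)}{\sum_{l=1}^n\exp\left(-\frac1{\beta_{t+1}}\sum_{k=1}^t g^k_l\right)},\quad i=1,\dots,n,\qquad \beta_t=M_2\sqrt{5t}.$$ Then for $N=\left\lceil 80\,M_2^2\ln^2 n/\varepsilon^2\right\rceil$ the minimum $f_*$ is attained, the random variable $f\big(\frac1N\sum_{k=1}^N x^k\big)$ is integrable, and $$E\left[f\Big(\frac1N\sum_{k=1}^N x^k\Big)\right]-f_*\le\varepsilon .$$ -/

import Mathlib

open MeasureTheory ProbabilityTheory

noncomputable section

namespace GradientFree

/-- `ℝⁿ` with the Euclidean norm. -/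
abbrev Vec (n : ℕ) : Type := EuclideanSpace ℝ (Fin n)

/-- The unit simplex `S_n(1) = {x ≥ 0 : ∑ xᵢ = 1}`. -/
def simplex (n : ℕ) : Set (Vec n) := {x | (∀ i, 0 ≤ x i) ∧ ∑ i, x i = 1}

/-- The closed `μ₀`-neighbourhood of the simplex; the functions are given there. -/
def closedNhd (n : ℕ) (μ₀ : ℝ) : Set (Vec n) := Metric.cthickening μ₀ (simplex n)

/-- The open `μ₀`-neighbourhood of the simplex; gradients are considered there. -/
def openNhd (n : ℕ) (μ₀ : ℝ) : Set (Vec n) := Metric.thickening μ₀ (simplex n)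

/-- The uniform distribution on the Euclidean unit sphere, as a measure on `ℝⁿ`: the normalised
surface measure. -/
def uniformSphere (n : ℕ) : Measure (Vec n) :=
  (((volume : Measure (Vec n)).toSphere Set.univ)⁻¹ •
    (volume : Measure (Vec n)).toSphere).map Subtype.val

/-- The root mean square `√(E[K(η)²])`. -/
def rms {H : Type*} [MeasurableSpace H] (ν : Measure H) (K : H → ℝ) : ℝ :=
  Real.sqrt (∫ h, K h ^ 2 ∂ν)

/-- The objective `f(x) = E_η[f(x; η)]`, where `ν` is the law of `η`. -/
def objective {n : ℕ} {H : Type*} [MeasurableSpace H] (ν : Measure H)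
    (f : Vec n → H → ℝ) (x : Vec n) : ℝ :=
  ∫ h, f x h ∂ν

/-- The smooth stochastic convex setting on the `μ₀`-neighbourhood of the simplex.  `K` and `L` are
the random Lipschitz constants `M₂(η)` of `f(·; η)` and `L₂(η)` of its gradient, in the Euclidean
norm. -/
structure SmoothSetting {n : ℕ} {H : Type*} [MeasurableSpace H] (ν : Measure H) (μ₀ : ℝ)
    (f : Vec n → H → ℝ) (K L : H → ℝ) : Prop where
  /-- The expectation `E_η[f(x; η)]` exists. -/
  integrable : ∀ x ∈ closedNhd n μ₀, Integrable (f x) ν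
  /-- `f(·; η)` is convex. -/
  convex : ∀ᵐ h ∂ν, ConvexOn ℝ (closedNhd n μ₀) (fun x => f x h)
  /-- `E_η[∇ₓ f(x; η)] = ∇ₓ E_η[f(x; η)]`. -/
  gradient_expectation : ∀ x ∈ openNhd n μ₀,
    Integrable (fun h => gradient (fun y => f y h) x) ν ∧
      HasGradientAt (objective ν f) (∫ h, gradient (fun y => f y h) x ∂ν) x
  /-- `|f(x; η) - f(y; η)| ≤ M₂(η) ‖x - y‖₂`. -/
  lipschitz : ∀ᵐ h ∂ν, ∀ x ∈ closedNhd n μ₀, ∀ y ∈ closedNhd n μ₀,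
    |f x h - f y h| ≤ K h * ‖x - y‖
  /-- `E[M₂(η)²] < ∞`. -/
  lipschitz_memLp : MemLp K 2 ν
  /-- `f(·; η)` is differentiable. -/
  differentiable : ∀ᵐ h ∂ν, ∀ x ∈ openNhd n μ₀, DifferentiableAt ℝ (fun y => f y h) x
  /-- `‖∇ₓ f(x; η) - ∇ₓ f(y; η)‖₂ ≤ L₂(η) ‖x - y‖₂`. -/
  gradient_lipschitz : ∀ᵐ h ∂ν, ∀ x ∈ openNhd n μ₀, ∀ y ∈ openNhd n μ₀,
    ‖gradient (fun z => f z h) x - gradient (fun z => f z h) y‖ ≤ L h * ‖x - y‖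
  /-- `E[L₂(η)²] < ∞`. -/
  gradient_lipschitz_memLp : MemLp L 2 ν

/-- Everything drawn before step `k`: directions, realisations of `η`, and both noises. -/
def history {n : ℕ} {H Ω : Type*} (e : ℕ → Ω → Vec n) (η : ℕ → Ω → H) (ξ ξ₀ : ℕ → Ω → ℝ)
    (k : ℕ) (ω : Ω) : Fin k → Vec n × H × ℝ × ℝ :=
  fun j => (e j ω, η j ω, ξ j ω, ξ₀ j ω)

/-- The randomness of the method and of the noisy two-point oracle.  At step `k` the direction `e k`
and the realisation `η k` are drawn, and the oracle returns `f(x + μ e; η) + ξ` and `f(x; η) + ξ₀`,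
with the same realisation `η k` in both answers.  The noises are bounded by `δ`, and each of them
does not depend on the direction that determines the query point; they may depend on `η k`, on each
other and on the past. -/
structure OracleModel {n : ℕ} {H Ω : Type*} [MeasurableSpace H] [MeasurableSpace Ω]
    (P : Measure Ω) (ν : Measure H) (δ : ℝ)
    (e : ℕ → Ω → Vec n) (η : ℕ → Ω → H) (ξ ξ₀ : ℕ → Ω → ℝ) : Prop where
  measurable_direction : ∀ k, Measurable (e k)
  measurable_realisation : ∀ k, Measurable (η k)
  measurable_noise : ∀ k, Measurable (ξ k)
  measurable_noise₀ : ∀ k, Measurable (ξ₀ k)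
  /-- Each direction is uniform on the Euclidean unit sphere. -/
  law_direction : ∀ k, P.map (e k) = uniformSphere n
  /-- Each realisation has the law `ν` of `η`. -/
  law_realisation : ∀ k, P.map (η k) = ν
  /-- The noise is bounded by `δ`. -/
  noise_le : ∀ k, ∀ᵐ ω ∂P, |ξ k ω| ≤ δ
  noise₀_le : ∀ k, ∀ᵐ ω ∂P, |ξ₀ k ω| ≤ δ
  /-- `η k` is drawn independently of the past. -/
  indep_realisation : ∀ k, IndepFun (η k) (history e η ξ ξ₀ k) P
  /-- `e k` is drawn independently of the past and of `η k`. -/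
  indep_direction : ∀ k, IndepFun (e k) (fun ω => (history e η ξ ξ₀ k ω, η k ω)) P
  /-- The noise at the shifted point is independent of the direction, given the past. -/
  indep_noise : ∀ k, IndepFun (e k) (fun ω => (history e η ξ ξ₀ k ω, ξ k ω)) P
  /-- The noise at the base point is independent of the direction, given the past. -/
  indep_noise₀ : ∀ k, IndepFun (e k) (fun ω => (history e η ξ ξ₀ k ω, ξ₀ k ω)) P

/-- The smoothing radius `min {max {ε/(2M₂), √(ε/L₂)}, (M₂/L₂)√(1/(6n))}`. -/
def smoothingRadius (n : ℕ) (ε M₂ L₂ : ℝ) : ℝ :=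
  min (max (ε / (2 * M₂)) (Real.sqrt (ε / L₂))) (M₂ / L₂ * Real.sqrt (1 / (6 * n)))

/-- The noisy gradient estimate
`(n/μ) (f(x + μ e; η) + ξ - (f(x; η) + ξ₀)) e`. -/
def gradEstimate {n : ℕ} {H : Type*} (f : Vec n → H → ℝ) (μ : ℝ) (x e : Vec n) (h : H)
    (ξ ξ₀ : ℝ) : Vec n :=
  ((n : ℝ) / μ * ((f (x + μ • e) h + ξ) - (f x h + ξ₀))) • e

/-- The point of the simplex with coordinates `exp (-sᵢ/β) / ∑ₗ exp (-sₗ/β)`. -/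
def mirror {n : ℕ} (β : ℝ) (s : Vec n) : Vec n :=
  WithLp.toLp 2 fun i => Real.exp (-(1 / β) * s i) / ∑ l, Real.exp (-(1 / β) * s l)

/-- The step parameter `β_t = M₂ √(5t)`. -/
def stepParam (M₂ : ℝ) (t : ℕ) : ℝ := M₂ * Real.sqrt (5 * t)

/-- The sum of the first `t` gradient estimates along the run of the method; the estimate number
`t + 1` is taken at the iterate `x^{t+1} = mirror β_{t+1} (sum of the first t estimates)`. -/
def estimateSum {n : ℕ} {H Ω : Type*} (f : Vec n → H → ℝ) (μ M₂ : ℝ)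
    (e : ℕ → Ω → Vec n) (η : ℕ → Ω → H) (ξ ξ₀ : ℕ → Ω → ℝ) (ω : Ω) : ℕ → Vec n
  | 0 => 0
  | t + 1 =>
      estimateSum f μ M₂ e η ξ ξ₀ ω t +
        gradEstimate f μ
          (mirror (stepParam M₂ (t + 1)) (estimateSum f μ M₂ e η ξ ξ₀ ω t))
          (e t ω) (η t ω) (ξ t ω) (ξ₀ t ω)

/-- The iterates, numbered from `0`: `iterate t` is `x^{t+1}`. -/
def iterate {n : ℕ} {H Ω : Type*} (f : Vec n → H → ℝ) (μ M₂ : ℝ)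
    (e : ℕ → Ω → Vec n) (η : ℕ → Ω → H) (ξ ξ₀ : ℕ → Ω → ℝ) (t : ℕ) (ω : Ω) : Vec n :=
  mirror (stepParam M₂ (t + 1)) (estimateSum f μ M₂ e η ξ ξ₀ ω t)

/-- The first iterate is the barycentre `(1/n, …, 1/n)`. -/
theorem iterate_zero {n : ℕ} {H Ω : Type*} (f : Vec n → H → ℝ) (μ M₂ : ℝ)
    (e : ℕ → Ω → Vec n) (η : ℕ → Ω → H) (ξ ξ₀ : ℕ → Ω → ℝ) (ω : Ω) (i : Fin n) :
    iterate f μ M₂ e η ξ ξ₀ 0 ω i = 1 / n := by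
  simp [iterate, mirror, estimateSum]

/-- The average `(1/N) ∑_{k=1}^N x^k` of the first `N` iterates. -/
def average {n : ℕ} {H Ω : Type*} (f : Vec n → H → ℝ) (μ M₂ : ℝ)
    (e : ℕ → Ω → Vec n) (η : ℕ → Ω → H) (ξ ξ₀ : ℕ → Ω → ℝ) (N : ℕ) (ω : Ω) : Vec n :=
  (1 / (N : ℝ)) • ∑ t ∈ Finset.range N, iterate f μ M₂ e η ξ ξ₀ t ω

/-- The number of iterations `⌈80 M₂² ln² n / ε²⌉`. -/
def iterationCount (n : ℕ) (ε M₂ : ℝ) : ℕ :=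
  ⌈80 * M₂ ^ 2 * Real.log n ^ 2 / ε ^ 2⌉₊

end GradientFree

end

/-! Let u minimise f on the simplex. By convexity the gap at the averaged iterate is at most the
mean of f(x^k) - f(u). Three estimates control this mean.

Regret. For dual averaging with the entropy, `regret_le` bounds ∑⟨g^k, x^k - u⟩ pathwise by β_N ln n
+ ∑ G_k²/(2β_k), where G_k bounds ‖g^k‖_∞. The maximum norm is dual to the norm natural for the
simplex, so the dimension enters only through ln n and E[G_k²].

Bias. The divergence theorem on the unit ball (`integral_ball_lineDeriv`) turns (n/μ)E[φ(x+μe)e]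
into the ball average of ∇φ(x+μu). Averaging the gradient inequality of convexity between x+μu and
y+μu gives the mean of φ(x+μu) minus the mean of φ(y+μu). By symmetry of the ball the former is at
least φ(x) and the latter at most φ(y) + min(M₂μ, L₂μ²/2), which is `SmoothConvex.first_moment_ge`.
The choice of μ makes the loss at most ε/2. The base value f(x;η) and the two noises multiply a
centred direction of which each is independent given the past, so they add no bias (`noise_term`).

Second moment. The increment is μ⟨∇φ(x), e⟩ up to Lμ²/2, and symmetry gives exactly E[⟨s,e⟩²‖e‖_∞²]
= ‖s‖² E[‖e‖_∞²]/n (`integral_inner_sq_supNorm`). The exact even moments of a coordinate, taken at a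
power of order ln n, give n E[‖e‖_∞²] ≤ (5/2) ln n (`mul_supMoment_le`). The bounds on μ and δ make
the remaining factor at most 2M₂², so E[G_k²] ≤ 5M₂² ln n.

With β_t = M₂√(5t) the expected regret is at most 2√5 M₂ ln n √N, which is at most Nε/2 for the
prescribed N; regret and bias together give ε.

Joint measurability of f(x;η) is not assumed. The Lipschitz condition provides a jointly measurable
version (`exists_measurable_version`) that produces the same run almost surely. -/

noncomputable section
namespace GradientFree

open Set Metric Filter Topology

set_option linter.unusedSectionVars false

/-! ### Radial cutoffs of the unit ball and their directional derivatives -/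

section Cutoff

section Normed

variable {E : Type*} [NormedAddCommGroup E]

/-- The radial cutoff that is `1` on the unit ball and decreases linearly to `0` on the shell
`1 ≤ ‖x‖ ≤ 1 + s`. -/
def cutoff (s : ℝ) (x : E) : ℝ := max 0 (min 1 ((1 + s - ‖x‖) / s))

theorem cutoff_of_le {s : ℝ} (hs : 0 < s) {x : E} (hx : ‖x‖ ≤ 1) : cutoff s x = 1 := by
  have : 1 ≤ (1 + s - ‖x‖) / s := by rw [le_div_iff₀ hs]; linarith
  simp [cutoff, this]

theorem cutoff_of_ge {s : ℝ} (hs : 0 < s) {x : E} (hx : 1 + s ≤ ‖x‖) : cutoff s x = 0 := by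
  have : (1 + s - ‖x‖) / s ≤ 0 := div_nonpos_of_nonpos_of_nonneg (by linarith) hs.le
  simp [cutoff, this]

theorem cutoff_of_mem {s : ℝ} (hs : 0 < s) {x : E} (hx : ‖x‖ ∈ Ioo 1 (1 + s)) :
    cutoff s x = (1 + s - ‖x‖) / s := by
  have h1 : 0 ≤ (1 + s - ‖x‖) / s := div_nonneg (by linarith [hx.2]) hs.le
  have h2 : (1 + s - ‖x‖) / s ≤ 1 := by rw [div_le_one hs]; linarith [hx.1]
  rw [cutoff, min_eq_right h2, max_eq_right h1]

theorem cutoff_mem_Icc (s : ℝ) (x : E) : cutoff s x ∈ Icc (0 : ℝ) 1 :=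
  ⟨le_max_left _ _, max_le zero_le_one (min_le_left _ _)⟩

theorem lipschitzWith_cutoff {s : ℝ} (hs : 0 < s) :
    LipschitzWith (Real.toNNReal s⁻¹) (cutoff s : E → ℝ) := by
  have h : LipschitzWith (Real.toNNReal s⁻¹) (fun x : E => (1 + s - ‖x‖) / s) := by
    refine LipschitzWith.of_dist_le_mul fun x y => ?_
    rw [Real.coe_toNNReal _ (inv_nonneg.2 hs.le), Real.dist_eq, ← sub_div, abs_div, abs_of_pos hs,
      div_eq_inv_mul, dist_eq_norm]
    gcongr
    rw [show 1 + s - ‖x‖ - (1 + s - ‖y‖) = -(‖x‖ - ‖y‖) by ring, abs_neg]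
    exact abs_norm_sub_norm_le x y
  exact (h.const_min 1).const_max 0

theorem hasCompactSupport_cutoff [ProperSpace E] {s : ℝ} (hs : 0 < s) :
    HasCompactSupport (cutoff s : E → ℝ) := by
  refine HasCompactSupport.intro (isCompact_closedBall (0 : E) (1 + s)) fun x hx => ?_
  exact cutoff_of_ge hs (by simpa using (le_of_not_ge (by simpa using hx)))

end Normed

variable {E : Type*} [NormedAddCommGroup E] [InnerProductSpace ℝ E]

theorem hasDerivAt_norm_line {x : E} (hx : x ≠ 0) (v : E) :
    HasDerivAt (fun t : ℝ => ‖x + t • v‖) (inner ℝ (‖x‖⁻¹ • x) v) 0 := by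
  have h0 : HasDerivAt (fun t : ℝ => x + t • v) v 0 := by
    simpa using ((hasDerivAt_id (0 : ℝ)).smul_const v).const_add x
  have h1 := h0.norm_sq.sqrt (by simpa using hx)
  simp only [zero_smul, add_zero] at h1
  convert h1 using 1
  · ext t; rw [Real.sqrt_sq (norm_nonneg _)]
  · rw [Real.sqrt_sq (norm_nonneg _), real_inner_smul_left]
    field_simp

/-- The direction is `-v` because integration by parts moves the derivative onto the cutoff in this
form. The two excluded spheres are where the cutoff has kinks; they are null sets. -/
theorem lineDeriv_cutoff {s : ℝ} (hs : 0 < s) (x v : E) (h1 : ‖x‖ ≠ 1) (h2 : ‖x‖ ≠ 1 + s) :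
    lineDeriv ℝ (cutoff s) x (-v) =
      s⁻¹ * (inner ℝ (‖x‖⁻¹ • x) v * (Ioo (1 : ℝ) (1 + s)).indicator 1 ‖x‖) := by
  have hc : Continuous fun t : ℝ => ‖x + t • (-v)‖ := by fun_prop
  have hc0 : (fun t : ℝ => ‖x + t • (-v)‖) 0 = ‖x‖ := by simp
  rcases lt_or_gt_of_ne h1 with h | h
  · have : (fun t : ℝ => cutoff s (x + t • (-v))) =ᶠ[𝓝 0] fun _ => 1 := by
      filter_upwards [hc.continuousAt.eventually_lt continuousAt_const (hc0 ▸ h)] with t ht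
      exact cutoff_of_le hs ht.le
    rw [lineDeriv, this.deriv_eq]
    simp [h.le.not_gt]
  · rcases lt_or_gt_of_ne h2 with h' | h'
    · have : (fun t : ℝ => cutoff s (x + t • (-v))) =ᶠ[𝓝 0]
          fun t => (1 + s - ‖x + t • (-v)‖) / s := by
        filter_upwards [hc.continuousAt.eventually_lt continuousAt_const (hc0 ▸ h'),
          continuousAt_const.eventually_lt hc.continuousAt (hc0 ▸ h)] with t ht ht'
        exact cutoff_of_mem hs ⟨ht', ht⟩
      rw [lineDeriv, this.deriv_eq]
      have hx : x ≠ 0 := by rintro rfl; simp at h; linarith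
      rw [(((hasDerivAt_norm_line hx (-v)).const_sub (1 + s)).div_const s).deriv]
      simp [h, h', div_eq_inv_mul]
    · have : (fun t : ℝ => cutoff s (x + t • (-v))) =ᶠ[𝓝 0] fun _ => 0 := by
        filter_upwards [continuousAt_const.eventually_lt hc.continuousAt (hc0 ▸ h')] with t ht
        exact cutoff_of_ge hs ht.le
      rw [lineDeriv, this.deriv_eq]
      simp [h'.le.not_gt]

end Cutoff

/-! ### Polar coordinates and the divergence theorem on the unit ball -/

section Sphere

variable {E : Type*} [NormedAddCommGroup E] [InnerProductSpace ℝ E] [FiniteDimensional ℝ E]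
  [MeasurableSpace E] [BorelSpace E] [Nontrivial E]

/-- Polar coordinates for a product of an angular and a radial function. -/
theorem integral_angular_mul_radial (H : E → ℝ) (k : ℝ → ℝ) :
    ∫ x : E, H (‖x‖⁻¹ • x) * k ‖x‖ =
      (∫ θ : sphere (0 : E) 1, H θ ∂(volume : Measure E).toSphere) *
        ∫ r in Ioi (0 : ℝ), r ^ (Module.finrank ℝ E - 1) * k r := by
  have h1 : ∫ x : E, H (‖x‖⁻¹ • x) * k ‖x‖ =
      ∫ x : ({(0)}ᶜ : Set E), H (‖x.1‖⁻¹ • x.1) * k ‖x.1‖ ∂((volume : Measure E).comap Subtype.val) := by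
    rw [integral_subtype_comap (measurableSet_singleton _).compl
      fun x : E => H (‖x‖⁻¹ • x) * k ‖x‖, restrict_compl_singleton]
  have h2 : ∫ x : ({(0)}ᶜ : Set E), H (‖x.1‖⁻¹ • x.1) * k ‖x.1‖ ∂((volume : Measure E).comap Subtype.val) =
      ∫ p : sphere (0 : E) 1 × Ioi (0 : ℝ), H p.1 * k p.2
        ∂(volume : Measure E).toSphere.prod (.volumeIoiPow (Module.finrank ℝ E - 1)) := by
    have := (volume : Measure E).measurePreserving_homeomorphUnitSphereProd.integral_comp
        (Homeomorph.measurableEmbedding _) (fun p : sphere (0 : E) 1 × Ioi (0 : ℝ) => H p.1 * k p.2)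
    simpa using this
  have h3 : ∫ r : Ioi (0 : ℝ), k r ∂(.volumeIoiPow (Module.finrank ℝ E - 1)) =
      ∫ r in Ioi (0 : ℝ), r ^ (Module.finrank ℝ E - 1) * k r := by
    simp only [Measure.volumeIoiPow, ENNReal.ofReal]
    rw [integral_withDensity_eq_integral_smul,
      integral_subtype_comap measurableSet_Ioi
        fun a ↦ Real.toNNReal (a ^ (Module.finrank ℝ E - 1)) • k a,
      setIntegral_congr_fun measurableSet_Ioi fun x hx ↦ ?_]
    · rw [NNReal.smul_def, Real.coe_toNNReal _ (pow_nonneg hx.out.le _), smul_eq_mul]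
    · exact (measurable_subtype_coe.pow_const _).real_toNNReal
  rw [h1, h2, ← h3]
  exact integral_prod_mul (fun θ : sphere (0 : E) 1 => H θ) (fun r : Ioi (0 : ℝ) => k r)

theorem integral_Ioi_pow_mul_indicator {m : ℕ} {a b : ℝ} (ha : 0 ≤ a) (hab : a ≤ b) :
    ∫ r in Ioi (0 : ℝ), r ^ m * (Ioo a b).indicator 1 r = (b ^ (m + 1) - a ^ (m + 1)) / (m + 1) := by
  have : ∀ r : ℝ, r ^ m * (Ioo a b).indicator 1 r = (Ioo a b).indicator (fun r => r ^ m) r := by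
    intro r; by_cases h : r ∈ Ioo a b <;> simp [h]
  simp_rw [this]
  rw [setIntegral_indicator measurableSet_Ioo]
  have h2 : Ioi (0 : ℝ) ∩ Ioo a b = Ioo a b :=
    inter_eq_right.2 fun x hx => lt_of_le_of_lt ha hx.1
  rw [h2, ← integral_Ioc_eq_integral_Ioo, ← intervalIntegral.integral_of_le hab, integral_pow]

/-- Integral over the unit ball of a positively homogeneous function of degree `j`. -/
theorem integral_ball_homogeneous (H : E → ℝ) (j : ℕ)
    (hH : ∀ x : E, x ≠ 0 → H x = ‖x‖ ^ j * H (‖x‖⁻¹ • x)) :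
    ∫ x in ball (0 : E) 1, H x = (∫ θ : sphere (0 : E) 1, H θ ∂(volume : Measure E).toSphere) /
      (Module.finrank ℝ E + j) := by
  have h1 : ∫ x in ball (0 : E) 1, H x =
      ∫ x : E, H (‖x‖⁻¹ • x) * (fun r : ℝ => r ^ j * (Ioo (0 : ℝ) 1).indicator 1 r) ‖x‖ := by
    rw [← integral_indicator measurableSet_ball]
    apply integral_congr_ae
    have : ∀ᵐ x : E, x ≠ 0 := by
      rw [ae_iff]; simp
    filter_upwards [this] with x hx
    have hx' : 0 < ‖x‖ := norm_pos_iff.2 hx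
    by_cases h : ‖x‖ < 1
    · rw [indicator_of_mem (by simpa using h), hH x hx]
      simp [h, hx', mul_comm]
    · rw [indicator_of_notMem (by simpa using h)]
      simp [h]
  rw [h1, integral_angular_mul_radial H (fun r : ℝ => r ^ j * (Ioo (0 : ℝ) 1).indicator 1 r)]
  have h2 : ∀ r : ℝ, r ^ (Module.finrank ℝ E - 1) * (r ^ j * (Ioo (0 : ℝ) 1).indicator 1 r) =
      r ^ (Module.finrank ℝ E - 1 + j) * (Ioo (0 : ℝ) 1).indicator 1 r := fun r => by ring
  simp_rw [h2]
  rw [integral_Ioi_pow_mul_indicator le_rfl zero_le_one]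
  have hd : 0 < Module.finrank ℝ E := Module.finrank_pos
  have h3 : ((Module.finrank ℝ E - 1 + j : ℕ) : ℝ) + 1 = Module.finrank ℝ E + j := by
    rw [Nat.cast_add, Nat.cast_sub hd]; push_cast; ring
  rw [h3]
  simp [div_eq_mul_inv]

/-- Invariance of Lebesgue measure passes to the sphere through polar coordinates; the radial factor
is the indicator of (0, 1), whose integral is nonzero and cancels. -/
theorem integral_toSphere_comp_isometry (T : E ≃ₗᵢ[ℝ] E) (H : E → ℝ) :
    ∫ θ : sphere (0 : E) 1, H (T θ) ∂(volume : Measure E).toSphere =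
      ∫ θ : sphere (0 : E) 1, H θ ∂(volume : Measure E).toSphere := by
  have h1 := integral_angular_mul_radial (fun x => H (T x)) ((Ioo (0 : ℝ) 1).indicator 1)
  have h2 := integral_angular_mul_radial H ((Ioo (0 : ℝ) 1).indicator 1)
  have h3 := (T.measurePreserving).integral_comp T.toMeasurableEquiv.measurableEmbedding
    (fun x => H (‖x‖⁻¹ • x) * (Ioo (0 : ℝ) 1).indicator 1 ‖x‖)
  simp only [LinearIsometryEquiv.norm_map, map_smul] at h1 h3
  rw [h3, h2, integral_Ioi_pow_mul_indicator le_rfl zero_le_one] at h1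
  refine (mul_right_cancel₀ ?_ h1).symm
  have : (0 : ℝ) < (Module.finrank ℝ E - 1 : ℕ) + 1 := by positivity
  simp [this.ne']

theorem ae_norm_ne {r : ℝ} : ∀ᵐ x : E, ‖x‖ ≠ r := by
  rw [ae_iff]
  have := Measure.addHaar_sphere (volume : Measure E) 0 r
  simpa [sphere, dist_zero_right] using this

theorem integrable_toSphere_of_continuous {H : E → ℝ} (hH : Continuous H) :
    Integrable (fun θ : sphere (0 : E) 1 => H θ) (volume : Measure E).toSphere :=
  (hH.comp continuous_subtype_val).integrable_of_hasCompactSupport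
    (HasCompactSupport.of_compactSpace _)

theorem tendsto_integral_mul_cutoff {G : E → ℝ} (hG : AEStronglyMeasurable G) {M : ℝ}
    (hM : ∀ x, |G x| ≤ M) :
    Tendsto (fun s : ℝ => ∫ x, G x * cutoff s x) (𝓝[>] 0) (𝓝 (∫ x in ball (0 : E) 1, G x)) := by
  rw [← integral_indicator measurableSet_ball]
  refine tendsto_integral_filter_of_dominated_convergence
    (fun x => (closedBall (0 : E) 2).indicator (fun _ => M) x) ?_ ?_ ?_ ?_
  · filter_upwards [self_mem_nhdsWithin] with s hs
    exact hG.mul (lipschitzWith_cutoff hs).continuous.aestronglyMeasurable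
  · filter_upwards [Ioo_mem_nhdsGT (zero_lt_one' ℝ)] with s hs
    refine ae_of_all _ fun x => ?_
    by_cases hx : ‖x‖ ≤ 2
    · rw [indicator_of_mem (by simpa using hx), Real.norm_eq_abs, abs_mul]
      have h1 := cutoff_mem_Icc s x
      rw [abs_of_nonneg h1.1]
      calc |G x| * cutoff s x ≤ |G x| * 1 := by gcongr; exact h1.2
        _ ≤ M := by rw [mul_one]; exact hM x
    · rw [cutoff_of_ge hs.1 (by linarith [hs.2, not_le.1 hx])]
      simp only [mul_zero, norm_zero]
      exact indicator_nonneg (fun _ _ => (abs_nonneg _).trans (hM x)) _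
  · exact (integrable_indicator_iff measurableSet_closedBall).2
      (integrableOn_const (measure_closedBall_lt_top.ne))
  · filter_upwards [ae_norm_ne (E := E) (r := 1)] with x hx
    rcases lt_or_gt_of_ne hx with h | h
    · rw [indicator_of_mem (by simpa using h)]
      refine tendsto_const_nhds.congr' ?_
      filter_upwards [self_mem_nhdsWithin] with s hs
      rw [cutoff_of_le hs h.le, mul_one]
    · rw [indicator_of_notMem (by simpa using h.le)]
      refine tendsto_const_nhds.congr' ?_
      filter_upwards [Ioo_mem_nhdsGT (sub_pos.2 h)] with s hs
      rw [cutoff_of_ge hs.1 (by linarith [hs.2]), mul_zero]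

/-- The integral is the difference quotient at 0 of (1+s)^(m+1)/(m+1), whose derivative there is 1.
-/
theorem tendsto_integral_Ioi_shell (m : ℕ) :
    Tendsto (fun s : ℝ => ∫ r in Ioi (0 : ℝ), r ^ m * (s⁻¹ * (Ioo (1 : ℝ) (1 + s)).indicator 1 r))
      (𝓝[>] 0) (𝓝 1) := by
  have h1 : HasDerivAt (fun s : ℝ => (1 + s) ^ (m + 1) / (m + 1)) 1 0 := by
    have := (((hasDerivAt_id (0 : ℝ)).const_add 1).pow (m + 1)).div_const ((m : ℝ) + 1)
    have hm : (m : ℝ) + 1 ≠ 0 := by positivity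
    simpa [hm] using this
  have h2 := h1.tendsto_slope_zero_right
  refine h2.congr' ?_
  filter_upwards [self_mem_nhdsWithin] with s hs
  have hs' : (0 : ℝ) < s := hs
  have h3 : ∀ r : ℝ, r ^ m * (s⁻¹ * (Ioo (1 : ℝ) (1 + s)).indicator 1 r) =
      s⁻¹ * (r ^ m * (Ioo (1 : ℝ) (1 + s)).indicator 1 r) := fun r => by ring
  rw [integral_congr_ae (ae_of_all _ h3), integral_const_mul, integral_Ioi_pow_mul_indicator zero_le_one (by linarith)]
  simp only [zero_add, smul_eq_mul, add_zero, one_pow]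
  ring

/-- The divergence theorem on the unit ball, for Lipschitz functions and constant directions. -/
theorem integral_ball_lineDeriv {F : E → ℝ} {C : NNReal} (hF : LipschitzWith C F) (v : E) :
    ∫ x in ball (0 : E) 1, lineDeriv ℝ F x v =
      ∫ θ : sphere (0 : E) 1, F θ * inner ℝ (θ : E) v ∂(volume : Measure E).toSphere := by
  -- The cutoff integrals have two limits as s → 0: the ball integral, and, after integration by
  -- parts, a shell integral tending to the sphere integral. Uniqueness of limits identifies them.
  have hL := tendsto_integral_mul_cutoff (E := E) (G := fun x => lineDeriv ℝ F x v)
    (aestronglyMeasurable_lineDeriv hF.continuous _)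
    (M := C * ‖v‖) (fun x => norm_lineDeriv_le_of_lipschitz ℝ hF)
  refine tendsto_nhds_unique hL ?_
  set d := Module.finrank ℝ E
  set I := ∫ θ : sphere (0 : E) 1, F θ * inner ℝ (θ : E) v ∂(volume : Measure E).toSphere
  let sh : ℝ → ℝ → ℝ := fun s r => s⁻¹ * (Ioo (1 : ℝ) (1 + s)).indicator 1 r
  have hsh0 : ∀ s > 0, ∀ r, 0 ≤ sh s r := fun s hs r =>
    mul_nonneg (inv_nonneg.2 (le_of_lt hs)) (indicator_nonneg (fun _ _ => zero_le_one) _)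
  have hint : ∀ s > 0, Integrable (fun x : E => sh s ‖x‖) := by
    intro s hs
    have h1 : (fun x : E => sh s ‖x‖) =
        ((fun x : E => ‖x‖) ⁻¹' Ioo 1 (1 + s)).indicator (fun _ => s⁻¹) := by
      ext x; simp [sh, indicator]
    rw [h1, integrable_indicator_iff (measurable_norm measurableSet_Ioo)]
    refine integrableOn_const (ne_of_lt ?_)
    refine (measure_mono fun x hx => ?_).trans_lt (measure_ball_lt_top (x := (0 : E)) (r := 1 + s))
    simpa using hx.2
  have hmain : Tendsto (fun s : ℝ => ∫ x : E, (F (‖x‖⁻¹ • x) * inner ℝ (‖x‖⁻¹ • x) v) * sh s ‖x‖)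
      (𝓝[>] 0) (𝓝 I) := by
    have := (tendsto_integral_Ioi_shell (d - 1)).const_mul I
    rw [mul_one] at this
    refine this.congr fun s => ?_
    exact (integral_angular_mul_radial (fun x => F x * inner ℝ x v) (sh s)).symm
  have hvol : ∀ s > 0, ∫ x : E, sh s ‖x‖ = (volume : Measure E).toSphere.real univ *
      ∫ r in Ioi (0 : ℝ), r ^ (d - 1) * sh s r := by
    intro s hs
    have := integral_angular_mul_radial (E := E) (fun _ => 1) (sh s)
    simpa using this
  have herr : Tendsto (fun s : ℝ => C * s * ‖v‖ * ∫ x : E, sh s ‖x‖) (𝓝[>] 0) (𝓝 0) := by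
    have h1 : Tendsto (fun s : ℝ => C * s * ‖v‖) (𝓝[>] 0) (𝓝 (C * 0 * ‖v‖)) :=
      ((tendsto_id.mono_left nhdsWithin_le_nhds).const_mul _).mul_const _
    have h2 := h1.mul ((tendsto_integral_Ioi_shell (d - 1)).const_mul
      ((volume : Measure E).toSphere.real univ))
    simp only [mul_zero, zero_mul] at h2
    refine h2.congr' ?_
    filter_upwards [self_mem_nhdsWithin] with s hs
    rw [hvol s hs]
  have hdist : ∀ s > 0, |(∫ x, lineDeriv ℝ F x v * cutoff s x) -
      ∫ x : E, (F (‖x‖⁻¹ • x) * inner ℝ (‖x‖⁻¹ • x) v) * sh s ‖x‖| ≤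
        C * s * ‖v‖ * ∫ x : E, sh s ‖x‖ := by
    intro s hs
    have hpart : ∫ x, lineDeriv ℝ F x v * cutoff s x =
        ∫ x : E, F x * inner ℝ (‖x‖⁻¹ • x) v * sh s ‖x‖ := by
      rw [hF.integral_lineDeriv_mul_eq (lipschitzWith_cutoff hs) (hasCompactSupport_cutoff hs)]
      refine integral_congr_ae ?_
      filter_upwards [ae_norm_ne (E := E) (r := 1), ae_norm_ne (E := E) (r := 1 + s)] with x h1 h2
      rw [lineDeriv_cutoff hs x v h1 h2]
      simp only [sh]; ring
    have hunit : ∀ x : E, |inner ℝ (‖x‖⁻¹ • x) v| ≤ ‖v‖ := fun x => by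
      refine (abs_real_inner_le_norm _ _).trans ?_
      have : ‖‖x‖⁻¹ • x‖ ≤ 1 := by
        rw [norm_smul, norm_inv, norm_norm]; exact inv_mul_le_one
      nlinarith [norm_nonneg v]
    have hmeas : Measurable fun x : E => ‖x‖⁻¹ • x := measurable_norm.inv.smul measurable_id
    have hFm := hF.continuous.measurable
    have hbd : ∀ x : E, sh s ‖x‖ ≠ 0 → 1 < ‖x‖ ∧ ‖x‖ < 1 + s := by
      intro x hx
      by_contra h
      exact hx (by simp only [sh]; rw [indicator_of_notMem (by simpa [mem_Ioo] using h), mul_zero])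
    -- On the shell the radial projection moves x by ‖x‖ - 1 < s, so the Lipschitz condition makes F
    -- angular up to an error C s.
    have hFerr : ∀ x : E, |F x - F (‖x‖⁻¹ • x)| * sh s ‖x‖ ≤ C * s * sh s ‖x‖ := by
      intro x
      by_cases hx : sh s ‖x‖ = 0
      · simp [hx]
      have hb := hbd x hx
      refine mul_le_mul_of_nonneg_right ?_ (hsh0 s hs _)
      have h1 := hF.dist_le_mul x (‖x‖⁻¹ • x)
      rw [Real.dist_eq, dist_eq_norm] at h1
      refine h1.trans (mul_le_mul_of_nonneg_left ?_ C.2)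
      have h2 : x - ‖x‖⁻¹ • x = (1 - ‖x‖⁻¹) • x := by rw [sub_smul, one_smul]
      have h3 : 0 < ‖x‖ := by linarith
      have h4 : 0 ≤ 1 - ‖x‖⁻¹ := sub_nonneg.2 (inv_le_one_of_one_le₀ hb.1.le)
      rw [h2, norm_smul, Real.norm_of_nonneg h4, sub_mul, inv_mul_cancel₀ h3.ne']
      linarith
    have hpt : ∀ x : E, |F x * inner ℝ (‖x‖⁻¹ • x) v * sh s ‖x‖ -
        F (‖x‖⁻¹ • x) * inner ℝ (‖x‖⁻¹ • x) v * sh s ‖x‖| ≤ C * s * ‖v‖ * sh s ‖x‖ := by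
      intro x
      rw [show F x * inner ℝ (‖x‖⁻¹ • x) v * sh s ‖x‖ -
        F (‖x‖⁻¹ • x) * inner ℝ (‖x‖⁻¹ • x) v * sh s ‖x‖ =
        inner ℝ (‖x‖⁻¹ • x) v * ((F x - F (‖x‖⁻¹ • x)) * sh s ‖x‖) by ring, abs_mul, abs_mul,
        abs_of_nonneg (hsh0 s hs _)]
      calc _ ≤ ‖v‖ * (C * s * sh s ‖x‖) :=
            mul_le_mul (hunit x) (hFerr x) (mul_nonneg (abs_nonneg _) (hsh0 s hs _)) (norm_nonneg _)
        _ = _ := by ring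
    have hshm : Measurable fun x : E => sh s ‖x‖ :=
      (measurable_const.mul ((measurable_one.indicator measurableSet_Ioo).comp measurable_norm))
    have hi2 : Integrable fun x : E => F (‖x‖⁻¹ • x) * inner ℝ (‖x‖⁻¹ • x) v * sh s ‖x‖ := by
      refine ((hint s hs).const_mul ((|F 0| + C) * ‖v‖)).mono' ?_ (ae_of_all _ fun x => ?_)
      · exact (((hFm.comp hmeas).mul (hmeas.inner_const)).mul hshm).aestronglyMeasurable
      · rw [Real.norm_eq_abs, abs_mul, abs_mul, abs_of_nonneg (hsh0 s hs _)]
        refine mul_le_mul_of_nonneg_right ?_ (hsh0 s hs _)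
        refine mul_le_mul ?_ (hunit x) (abs_nonneg _) (by positivity)
        have h1 := hF.dist_le_mul (‖x‖⁻¹ • x) 0
        rw [Real.dist_eq, dist_eq_norm, sub_zero] at h1
        have h2 : ‖‖x‖⁻¹ • x‖ ≤ 1 := by
          rw [norm_smul, norm_inv, norm_norm]; exact inv_mul_le_one
        have h3 := abs_sub_abs_le_abs_sub (F (‖x‖⁻¹ • x)) (F 0)
        nlinarith [C.2]
    have hi1 : Integrable fun x : E => F x * inner ℝ (‖x‖⁻¹ • x) v * sh s ‖x‖ := by
      have : Integrable fun x : E => F x * inner ℝ (‖x‖⁻¹ • x) v * sh s ‖x‖ -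
          F (‖x‖⁻¹ • x) * inner ℝ (‖x‖⁻¹ • x) v * sh s ‖x‖ := by
        refine ((hint s hs).const_mul (C * s * ‖v‖)).mono' ?_ (ae_of_all _ hpt)
        exact (((hFm.mul (hmeas.inner_const)).mul hshm).sub
          (((hFm.comp hmeas).mul (hmeas.inner_const)).mul hshm)).aestronglyMeasurable
      exact (this.add hi2).congr (ae_of_all _ fun x => sub_add_cancel _ _)
    rw [hpart, ← integral_sub hi1 hi2, ← integral_const_mul, ← Real.norm_eq_abs]
    exact norm_integral_le_of_norm_le ((hint s hs).const_mul _) (ae_of_all _ hpt)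
  have hdiff : Tendsto (fun s : ℝ => (∫ x, lineDeriv ℝ F x v * cutoff s x) -
      ∫ x : E, (F (‖x‖⁻¹ • x) * inner ℝ (‖x‖⁻¹ • x) v) * sh s ‖x‖) (𝓝[>] 0) (𝓝 0) := by
    refine squeeze_zero_norm' ?_ herr
    filter_upwards [self_mem_nhdsWithin] with s hs
    exact hdist s hs
  simpa using hdiff.add hmain

end Sphere

section SphereLip
variable {E : Type*} [NormedAddCommGroup E] [InnerProductSpace ℝ E] [FiniteDimensional ℝ E]
  [MeasurableSpace E] [BorelSpace E] [Nontrivial E]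

/-- A Lipschitz extension to the whole space has the same derivatives in the open ball and the same
values on the sphere, and both sides see nothing else of F. -/
theorem integral_ball_of_hasLineDerivAt {F F' : E → ℝ} {C : NNReal}
    (hF : LipschitzOnWith C F (closedBall 0 1)) (v : E)
    (hF' : ∀ x ∈ ball (0 : E) 1, HasLineDerivAt ℝ F (F' x) x v) :
    ∫ x in ball (0 : E) 1, F' x =
      ∫ θ : sphere (0 : E) 1, F θ * inner ℝ (θ : E) v ∂(volume : Measure E).toSphere := by
  obtain ⟨G, hG, hFG⟩ := hF.extend_real
  have h1 : ∫ x in ball (0 : E) 1, F' x = ∫ x in ball (0 : E) 1, lineDeriv ℝ G x v := by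
    refine setIntegral_congr_fun measurableSet_ball fun x hx => ?_
    have hc : Tendsto (fun t : ℝ => x + t • v) (𝓝 0) (𝓝 x) := by
      have : Continuous fun t : ℝ => x + t • v := by fun_prop
      simpa using this.tendsto 0
    have : (fun t : ℝ => G (x + t • v)) =ᶠ[𝓝 0] fun t => F (x + t • v) := by
      filter_upwards [hc (isOpen_ball.mem_nhds hx)] with t ht
      exact (hFG (ball_subset_closedBall ht)).symm
    change F' x = deriv _ 0
    rw [this.deriv_eq]
    exact (hF' x hx).lineDeriv.symm
  rw [h1, integral_ball_lineDeriv hG v]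
  refine integral_congr_ae (ae_of_all _ fun θ => ?_)
  simp only
  rw [hFG (sphere_subset_closedBall θ.2)]

end SphereLip

/-! ### Moments of a uniform direction -/

section Uniform

variable {n : ℕ} [NeZero n]

instance : Nontrivial (Vec n) := by
  refine ⟨⟨EuclideanSpace.single 0 1, 0, fun h => ?_⟩⟩
  have := congrArg norm h
  simp at this

theorem toSphere_univ_ne_zero : (volume : Measure (Vec n)).toSphere univ ≠ 0 := by
  rw [Measure.measure_univ_ne_zero]
  exact Measure.toSphere_ne_zero _

/-- The volume of the unit ball. -/
def ballVolume (n : ℕ) : ℝ := (volume : Measure (Vec n)).real (ball 0 1)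

theorem ballVolume_pos : 0 < ballVolume n :=
  ENNReal.toReal_pos (measure_ball_pos _ _ one_pos).ne' measure_ball_lt_top.ne

theorem integral_uniformSphere (g : Vec n → ℝ) :
    ∫ e, g e ∂uniformSphere n = (n * ballVolume n)⁻¹ *
      ∫ θ : sphere (0 : Vec n) 1, g θ ∂(volume : Measure (Vec n)).toSphere := by
  rw [uniformSphere, (MeasurableEmbedding.subtype_coe isClosed_sphere.measurableSet).integral_map,
    integral_smul_measure]
  simp [ballVolume, Measure.real]

instance isProbabilityMeasure_uniformSphere : IsProbabilityMeasure (uniformSphere n) := by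
  constructor
  rw [uniformSphere, Measure.map_apply measurable_subtype_coe .univ, preimage_univ,
    Measure.smul_apply, smul_eq_mul]
  exact ENNReal.inv_mul_cancel toSphere_univ_ne_zero (measure_lt_top _ _).ne

theorem ae_norm_eq_one : ∀ᵐ e ∂uniformSphere n, ‖e‖ = 1 := by
  rw [uniformSphere, ae_map_iff measurable_subtype_coe.aemeasurable
    (measurableSet_eq_fun measurable_norm measurable_const)]
  exact ae_of_all _ fun θ => by simp

theorem integrable_uniformSphere {g : Vec n → ℝ} (hg : Continuous g) :
    Integrable g (uniformSphere n) := by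
  rw [uniformSphere, (MeasurableEmbedding.subtype_coe
    isClosed_sphere.measurableSet).integrable_map_iff]
  exact (integrable_toSphere_of_continuous hg).smul_measure
    (ENNReal.inv_ne_top.2 toSphere_univ_ne_zero)

theorem integral_uniformSphere_comp (T : Vec n ≃ₗᵢ[ℝ] Vec n) (g : Vec n → ℝ) :
    ∫ e, g (T e) ∂uniformSphere n = ∫ e, g e ∂uniformSphere n := by
  rw [integral_uniformSphere, integral_uniformSphere, integral_toSphere_comp_isometry]

theorem integral_uniformSphere_inner (v : Vec n) : ∫ e, inner ℝ e v ∂uniformSphere n = 0 := by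
  have := integral_uniformSphere_comp (LinearIsometryEquiv.neg ℝ) (fun e : Vec n => inner ℝ e v)
  simp only [LinearIsometryEquiv.coe_neg, inner_neg_left] at this
  rw [integral_neg] at this
  linarith

theorem integral_ball_eq_uniformSphere {F F' : Vec n → ℝ} {C : NNReal}
    (hF : LipschitzOnWith C F (closedBall 0 1)) (v : Vec n)
    (hF' : ∀ x ∈ ball (0 : Vec n) 1, HasLineDerivAt ℝ F (F' x) x v) :
    ∫ x in ball (0 : Vec n) 1, F' x =
      n * ballVolume n * ∫ e, F e * inner ℝ e v ∂uniformSphere n := by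
  have h : (n * ballVolume n : ℝ) ≠ 0 :=
    mul_ne_zero (Nat.cast_ne_zero.2 (NeZero.ne n)) ballVolume_pos.ne'
  rw [integral_ball_of_hasLineDerivAt hF v hF', integral_uniformSphere, mul_inv_cancel_left₀ h]

/-- Apply the divergence theorem to x_i^(2p+1) in direction i. The derivative is homogeneous of
degree 2p, so its ball integral returns to the sphere with the factor 1/(n+2p). -/
theorem integral_uniformSphere_coord_pow_succ (i : Fin n) (p : ℕ) :
    ∫ e, e i ^ (2 * (p + 1)) ∂uniformSphere n =
      (2 * p + 1) / (n + 2 * p) * ∫ e, e i ^ (2 * p) ∂uniformSphere n := by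
  have hc : ContDiff ℝ 1 fun x : Vec n => x i ^ (2 * p + 1) := by fun_prop
  obtain ⟨C, hC⟩ := hc.contDiffOn.exists_lipschitzOnWith (by norm_num) (convex_closedBall (0 : Vec n) 1)
    (isCompact_closedBall _ _)
  have h1 := integral_ball_eq_uniformSphere hC (EuclideanSpace.single i 1)
    (F' := fun x => (2 * p + 1) * x i ^ (2 * p)) (fun x _ => by
      have h0 : HasDerivAt (fun t : ℝ => x i + t * 1) 1 0 := by
        simpa using ((hasDerivAt_id (0 : ℝ)).const_add (x i))
      have := h0.fun_pow (2 * p + 1)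
      simpa [HasLineDerivAt] using this)
  have h2 := integral_ball_homogeneous (fun x : Vec n => x i ^ (2 * p)) (2 * p) (fun x hx => by
    have : ‖x‖ ≠ 0 := norm_ne_zero_iff.2 hx
    simp only [PiLp.smul_apply, smul_eq_mul]
    rw [← mul_pow, mul_inv_cancel_left₀ this])
  have h3 : (fun e : Vec n => e i ^ (2 * (p + 1))) = fun e : Vec n =>
      e i ^ (2 * p + 1) * inner ℝ e (EuclideanSpace.single i 1) := by
    ext e; simp [EuclideanSpace.inner_single_right]; ring
  have h : (n * ballVolume n : ℝ) ≠ 0 :=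
    mul_ne_zero (Nat.cast_ne_zero.2 (NeZero.ne n)) ballVolume_pos.ne'
  rw [integral_const_mul, h2] at h1
  rw [h3, integral_uniformSphere (fun e : Vec n => e i ^ (2 * p)), eq_comm, ← mul_right_inj' h, ← h1]
  simp only [finrank_euclideanSpace, Fintype.card_fin]
  have hb := (ballVolume_pos (n := n)).ne'
  have hn : (n : ℝ) ≠ 0 := Nat.cast_ne_zero.2 (NeZero.ne n)
  push_cast
  field_simp

theorem integral_uniformSphere_coord_pow_le (i : Fin n) (p : ℕ) :
    ∫ e, e i ^ (2 * p) ∂uniformSphere n ≤ (∏ j ∈ Finset.range p, (2 * j + 1 : ℝ)) / n ^ p := by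
  have hn : (0 : ℝ) < n := Nat.cast_pos.2 (NeZero.pos n)
  induction p with
  | zero => simp
  | succ p ih =>
    rw [integral_uniformSphere_coord_pow_succ, Finset.prod_range_succ, pow_succ, mul_div_mul_comm,
      mul_comm]
    refine mul_le_mul ih ?_ (by positivity) (by positivity)
    gcongr
    linarith [(Nat.cast_nonneg p : (0 : ℝ) ≤ p)]

theorem integral_uniformSphere_coord_pow_four (i : Fin n) :
    ∫ e, e i ^ 4 ∂uniformSphere n = 3 / (n * (n + 2)) := by
  have h1 := integral_uniformSphere_coord_pow_succ i 1
  have h0 := integral_uniformSphere_coord_pow_succ i 0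
  norm_num at h0 h1
  rw [h1, h0]
  have hn : (0 : ℝ) < n := Nat.cast_pos.2 (NeZero.pos n)
  field_simp

/-- The maximum norm of a vector. -/
def supNorm (x : Vec n) : ℝ := ‖WithLp.ofLp x‖

theorem continuous_supNorm : Continuous (supNorm : Vec n → ℝ) :=
  continuous_norm.comp (PiLp.continuous_ofLp 2 _)

theorem supNorm_nonneg (x : Vec n) : 0 ≤ supNorm x := norm_nonneg _

theorem abs_apply_le_supNorm (x : Vec n) (i : Fin n) : |x i| ≤ supNorm x :=
  norm_le_pi_norm (WithLp.ofLp x) i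

theorem exists_supNorm_eq (x : Vec n) : ∃ i, supNorm x = |x i| := by
  obtain ⟨i, -, hi⟩ := Finset.exists_max_image Finset.univ (fun i => |x i|) ⟨0, Finset.mem_univ _⟩
  refine ⟨i, le_antisymm ?_ (abs_apply_le_supNorm x i)⟩
  exact (pi_norm_le_iff_of_nonneg (abs_nonneg _)).2 fun j => hi j (Finset.mem_univ _)

theorem supNorm_le_norm (x : Vec n) : supNorm x ≤ ‖x‖ := by
  obtain ⟨i, hi⟩ := exists_supNorm_eq x
  rw [hi]; exact PiLp.norm_apply_le x i

theorem supNorm_pow_le_sum (x : Vec n) (p : ℕ) : (supNorm x ^ 2) ^ p ≤ ∑ i, x i ^ (2 * p) := by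
  obtain ⟨i, hi⟩ := exists_supNorm_eq x
  rw [hi, sq_abs, ← pow_mul]
  exact Finset.single_le_sum (f := fun i => x i ^ (2 * p))
    (fun j _ => by rw [pow_mul]; positivity) (Finset.mem_univ i)

/-- The second moment of the maximum norm of a uniform direction. -/
def supMoment (n : ℕ) : ℝ := ∫ e, ‖WithLp.ofLp e‖ ^ 2 ∂uniformSphere n

theorem supMoment_eq : supMoment n = ∫ e, supNorm e ^ 2 ∂uniformSphere n := rfl

theorem supMoment_nonneg : 0 ≤ supMoment n := integral_nonneg fun _ => sq_nonneg _

/-- The graph of y^p lies above its tangent at t; this is Bernoulli's inequality for y/t. -/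
theorem young_pow {t y : ℝ} (ht : 0 < t) (hy : 0 ≤ y) {p : ℕ} (hp : 1 ≤ p) :
    p * t ^ (p - 1) * y ≤ (p - 1) * t ^ p + y ^ p := by
  have h := one_add_mul_le_pow (a := y / t - 1) (by have := div_nonneg hy ht.le; linarith) p
  rw [add_sub_cancel, div_pow, le_div_iff₀ (by positivity)] at h
  obtain ⟨q, rfl⟩ := Nat.exists_eq_add_of_le' hp
  simp only [Nat.add_sub_cancel] at *
  have h2 : (1 + ((q + 1 : ℕ) : ℝ) * (y / t - 1)) * t ^ (q + 1) =
      t ^ (q + 1) + ((q + 1 : ℕ) : ℝ) * (y * t ^ q - t ^ (q + 1)) := by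
    field_simp
    ring
  rw [h2] at h
  nlinarith

/-- The maximum is bounded by the sum, ‖e‖_∞^(2p) ≤ ∑ e_i^(2p). The tangent inequality with y =
‖e‖_∞² then replaces Jensen's inequality and avoids p-th roots. -/
theorem supMoment_le_of_moment {t : ℝ} (ht : 0 < t) {p : ℕ} (hp : 1 ≤ p)
    (h : ∑ i : Fin n, ∫ e, e i ^ (2 * p) ∂uniformSphere n ≤ t ^ p) : supMoment n ≤ t := by
  have hi : Integrable (fun e : Vec n => supNorm e ^ 2) (uniformSphere n) :=
    integrable_uniformSphere (continuous_supNorm.pow 2)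
  have hi2 : ∀ i, Integrable (fun e : Vec n => e i ^ (2 * p)) (uniformSphere n) := fun i =>
    integrable_uniformSphere (by fun_prop)
  have h1 : ∫ e, p * t ^ (p - 1) * supNorm e ^ 2 ∂uniformSphere n ≤
      ∫ e, ((p - 1) * t ^ p + ∑ i : Fin n, e i ^ (2 * p)) ∂uniformSphere n := by
    refine integral_mono (hi.const_mul _)
      ((integrable_const _).add (integrable_finsetSum _ fun i _ => hi2 i)) fun e => ?_
    exact (young_pow ht (sq_nonneg _) hp).trans (by gcongr; exact supNorm_pow_le_sum e p)
  rw [integral_const_mul, integral_add (integrable_const _)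
    (integrable_finsetSum _ fun i _ => hi2 i), integral_finsetSum _ fun i _ => hi2 i,
    ← supMoment_eq] at h1
  simp only [integral_const, probReal_univ, one_smul] at h1
  have h2 : p * t ^ (p - 1) * supMoment n ≤ p * t ^ (p - 1) * t := by
    have : t ^ p = t ^ (p - 1) * t := by rw [← pow_succ, Nat.sub_add_cancel hp]
    rw [mul_assoc _ _ t, ← this]; linarith
  have hp' : (0 : ℝ) < p := by exact_mod_cast hp
  exact le_of_mul_le_mul_left h2 (by positivity)

/-- Reversing the sign of coordinate i preserves the law and the maximum norm but negates the
integrand. -/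
theorem integral_coord_mul_coord_supNorm {i j : Fin n} (hij : i ≠ j) :
    ∫ e, e i * e j * supNorm e ^ 2 ∂uniformSphere n = 0 := by
  let T : Vec n ≃ₗᵢ[ℝ] Vec n := LinearIsometryEquiv.piLpCongrRight 2
    fun k => if k = i then LinearIsometryEquiv.neg ℝ else LinearIsometryEquiv.refl ℝ ℝ
  have hT : ∀ (e : Vec n) k, (T e) k = if k = i then -e k else e k := by
    intro e k
    by_cases hk : k = i <;> simp [T, hk]
  have hs : ∀ e : Vec n, supNorm (T e) = supNorm e := by
    intro e
    have : ∀ k, |T e k| = |e k| := fun k => by rw [hT]; split_ifs <;> simp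
    apply le_antisymm <;> refine (pi_norm_le_iff_of_nonneg (supNorm_nonneg _)).2 fun k => ?_
    · rw [Real.norm_eq_abs, this]; exact abs_apply_le_supNorm e k
    · rw [Real.norm_eq_abs, ← this]; exact abs_apply_le_supNorm (T e) k
  have h := integral_uniformSphere_comp T (fun e => e i * e j * supNorm e ^ 2)
  simp only [hs, hT, if_true, if_neg hij.symm, neg_mul] at h
  rw [integral_neg] at h
  linarith

theorem integral_coord_sq_supNorm (i j : Fin n) :
    ∫ e, e i ^ 2 * supNorm e ^ 2 ∂uniformSphere n =
      ∫ e, e j ^ 2 * supNorm e ^ 2 ∂uniformSphere n := by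
  let T : Vec n ≃ₗᵢ[ℝ] Vec n := LinearIsometryEquiv.piLpCongrLeft 2 ℝ ℝ (Equiv.swap i j)
  have hT : ∀ (e : Vec n) k, (T e) k = e (Equiv.swap i j k) := by
    intro e k
    simp [T, LinearIsometryEquiv.piLpCongrLeft_apply, Equiv.piCongrLeft'_apply]
  have hs : ∀ e : Vec n, supNorm (T e) = supNorm e := by
    intro e
    apply le_antisymm <;> refine (pi_norm_le_iff_of_nonneg (supNorm_nonneg _)).2 fun k => ?_
    · rw [Real.norm_eq_abs, hT]; exact abs_apply_le_supNorm e _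
    · have := abs_apply_le_supNorm (T e) (Equiv.swap i j k)
      rwa [hT, Equiv.swap_apply_self] at this
  have h := integral_uniformSphere_comp T (fun e => e j ^ 2 * supNorm e ^ 2)
  simpa only [hs, hT, Equiv.swap_apply_right] using h

/-- Swapping coordinates makes the n integrals equal, and they add up to `supMoment n` because ∑
e_j² = 1. -/
theorem integral_coord_sq_supNorm_eq (i : Fin n) :
    ∫ e, e i ^ 2 * supNorm e ^ 2 ∂uniformSphere n = supMoment n / n := by
  have h1 : ∑ j : Fin n, ∫ e, e j ^ 2 * supNorm e ^ 2 ∂uniformSphere n = supMoment n := by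
    have hi : ∀ j : Fin n, Integrable (fun e : Vec n => e j ^ 2 * supNorm e ^ 2)
        (uniformSphere n) := fun j => integrable_uniformSphere
      ((by fun_prop : Continuous fun e : Vec n => e j ^ 2).mul (continuous_supNorm.pow 2))
    rw [← integral_finsetSum _ fun j _ => hi j, supMoment_eq]
    refine integral_congr_ae ?_
    filter_upwards [ae_norm_eq_one] with e he
    rw [← Finset.sum_mul]
    have : ∑ j, e j ^ 2 = 1 := by rw [← EuclideanSpace.real_norm_sq_eq, he, one_pow]
    rw [this, one_mul]
  rw [Finset.sum_congr rfl fun j _ => integral_coord_sq_supNorm j i] at h1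
  simp only [Finset.sum_const, Finset.card_univ, Fintype.card_fin, nsmul_eq_mul] at h1
  rw [← h1, mul_div_cancel_left₀ _ (Nat.cast_ne_zero.2 (NeZero.ne n))]

/-- The matrix E[‖e‖_∞² e eᵀ] is a multiple of the identity: its off-diagonal entries vanish and its
diagonal entries coincide. -/
theorem integral_inner_sq_supNorm (s : Vec n) :
    ∫ e, inner ℝ s e ^ 2 * supNorm e ^ 2 ∂uniformSphere n = ‖s‖ ^ 2 * (supMoment n / n) := by
  have h1 : ∀ e : Vec n, inner ℝ s e ^ 2 * supNorm e ^ 2 =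
      ∑ i, ∑ j, s i * s j * (e i * e j * supNorm e ^ 2) := by
    intro e
    rw [PiLp.inner_apply, sq, Finset.sum_mul_sum, Finset.sum_mul]
    refine Finset.sum_congr rfl fun i _ => ?_
    rw [Finset.sum_mul]
    refine Finset.sum_congr rfl fun j _ => ?_
    simp; ring
  have hi : ∀ i j, Integrable (fun e : Vec n => s i * s j * (e i * e j * supNorm e ^ 2))
      (uniformSphere n) := fun i j => integrable_uniformSphere
    (continuous_const.mul ((by fun_prop : Continuous fun e : Vec n => e i * e j).mul
      (continuous_supNorm.pow 2)))
  simp_rw [h1]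
  rw [integral_finsetSum _ fun i _ => integrable_finsetSum _ fun j _ => hi i j,
    EuclideanSpace.real_norm_sq_eq, Finset.sum_mul]
  refine Finset.sum_congr rfl fun i _ => ?_
  rw [integral_finsetSum _ fun j _ => hi i j, Finset.sum_eq_single i]
  · rw [integral_const_mul]
    simp_rw [← sq]
    rw [integral_coord_sq_supNorm_eq]
  · intro j _ hj
    rw [integral_const_mul, integral_coord_mul_coord_supNorm hj.symm, mul_zero]
  · simp

end Uniform

/-! ### The logarithmic bound for the maximum norm -/

section LogBound

/-- From m to m+1 the left side gains (2m+3)e and the right side (5/2)(m+1)((m+1)/m)^(m+1), with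
((m+1)/m)^(m+1) ≥ e. The induction starts at 2, where the claim is 15e² ≤ 125; it fails at 1. -/
theorem prod_odd_mul_exp_le {m : ℕ} (hm : 2 ≤ m) :
    (∏ j ∈ Finset.range (m + 1), (2 * j + 1 : ℝ)) * Real.exp m ≤ (5 / 2 * m) ^ (m + 1) := by
  induction m, hm using Nat.le_induction with
  | base =>
    have h1 := Real.exp_one_lt_d9
    have h2 : Real.exp ((2 : ℕ) : ℝ) = Real.exp 1 ^ 2 := by rw [← Real.exp_nat_mul]; simp
    have h3 : Real.exp 1 ^ 2 ≤ 2.72 ^ 2 := by gcongr; linarith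
    rw [h2]
    simp only [Finset.prod_range_succ, Finset.prod_range_zero]
    norm_num at h3 ⊢
    linarith
  | succ m hm ih =>
    have hm0 : (0 : ℝ) < m := by exact_mod_cast (by omega : 0 < m)
    have hm2 : (2 : ℝ) ≤ m := by exact_mod_cast hm
    have he : Real.exp 1 ≤ ((m + 1) / m : ℝ) ^ (m + 1) := by
      have h1 : (1 : ℝ) ≤ (m + 1) * Real.log ((m + 1) / m) := by
        have := Real.one_sub_inv_le_log_of_pos (x := ((m + 1) / m : ℝ)) (by positivity)
        have h2 : 1 - ((m + 1) / m : ℝ)⁻¹ = 1 / (m + 1) := by field_simp; ring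
        rw [h2, div_le_iff₀ (by positivity)] at this
        linarith
      calc Real.exp 1 ≤ Real.exp ((m + 1 : ℕ) * Real.log ((m + 1) / m)) := by
            apply Real.exp_le_exp.2; push_cast; exact h1
        _ = _ := by rw [Real.exp_nat_mul, Real.exp_log (by positivity)]
    rw [Finset.prod_range_succ, Nat.cast_succ, Real.exp_add]
    calc _ = ((∏ j ∈ Finset.range (m + 1), (2 * j + 1 : ℝ)) * Real.exp m) *
          ((2 * (m + 1) + 1) * Real.exp 1) := by ring
      _ ≤ (5 / 2 * m) ^ (m + 1) * ((5 / 2 * (m + 1)) * ((m + 1) / m : ℝ) ^ (m + 1)) := by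
          gcongr
          linarith
      _ = (5 / 2 * (m + 1)) ^ (m + 1 + 1) := by
          rw [div_pow, mul_pow, pow_succ (5 / 2 * (m + 1 : ℝ)), mul_pow]
          field_simp

theorem prod_odd_mul_exp_le' {m : ℕ} (hm : 2 ≤ m) {l : ℝ} (h1 : m ≤ l) (h2 : l ≤ m + 1) :
    (∏ j ∈ Finset.range (m + 1), (2 * j + 1 : ℝ)) * Real.exp l ≤ (5 / 2 * l) ^ (m + 1) := by
  have hm0 : (0 : ℝ) < m := by exact_mod_cast (by omega : 0 < m)
  have hl : 0 < l := hm0.trans_le h1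
  -- By log x ≥ 1 - 1/x it suffices that l - m ≤ (m+1)(l-m)/l, which is where l ≤ m+1 enters.
  have he : Real.exp (l - m) ≤ (l / m) ^ (m + 1) := by
    have h3 : l - m ≤ (m + 1) * Real.log (l / m) := by
      have := Real.one_sub_inv_le_log_of_pos (x := l / m) (by positivity)
      have h4 : l - m ≤ (m + 1) * (1 - (l / m)⁻¹) := by
        rw [inv_div, one_sub_div hl.ne', mul_div_assoc', le_div_iff₀ hl]
        nlinarith
      nlinarith
    calc Real.exp (l - m) ≤ Real.exp ((m + 1 : ℕ) * Real.log (l / m)) := by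
          apply Real.exp_le_exp.2; push_cast; exact h3
      _ = _ := by rw [Real.exp_nat_mul, Real.exp_log (by positivity)]
  calc _ = ((∏ j ∈ Finset.range (m + 1), (2 * j + 1 : ℝ)) * Real.exp m) * Real.exp (l - m) := by
        rw [mul_assoc, ← Real.exp_add]; congr 2; ring
    _ ≤ (5 / 2 * m) ^ (m + 1) * (l / m) ^ (m + 1) := by
        gcongr; exact prod_odd_mul_exp_le hm
    _ = _ := by rw [← mul_pow]; congr 1; field_simp

/-- The fourth-moment condition for small n. It is nearly an equality at n = 2, where 12 is compared
with about 12.01. -/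
theorem three_mul_sq_le_log {n : ℕ} (h2 : 2 ≤ n) (h7 : n ≤ 7) :
    3 * (n : ℝ) ^ 2 ≤ (5 / 2 * Real.log n) ^ 2 * (n + 2) := by
  have l2 := Real.log_two_gt_d9
  have l3 : 1 ≤ Real.log 3 := by
    rw [Real.le_log_iff_exp_le (by norm_num)]; linarith [Real.exp_one_lt_d9]
  have l4 : Real.log 4 = 2 * Real.log 2 := by
    rw [show (4 : ℝ) = 2 ^ 2 by norm_num, Real.log_pow]; norm_num
  have l6 : Real.log 6 = Real.log 2 + Real.log 3 := by
    rw [← Real.log_mul (by norm_num) (by norm_num)]; norm_num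
  have l5 : Real.log 4 ≤ Real.log 5 := Real.log_le_log (by norm_num) (by norm_num)
  have l7 : Real.log 6 ≤ Real.log 7 := Real.log_le_log (by norm_num) (by norm_num)
  interval_cases n <;> push_cast
  · nlinarith
  · nlinarith
  · nlinarith
  · nlinarith
  · nlinarith
  · nlinarith

theorem mul_supMoment_le {n : ℕ} (hn : 2 ≤ n) : n * supMoment n ≤ 5 / 2 * Real.log n := by
  have : NeZero n := ⟨by omega⟩
  have hn0 : (0 : ℝ) < n := by exact_mod_cast (by omega : 0 < n)
  have hlog : 0 < Real.log n := Real.log_pos (by exact_mod_cast (by omega : 1 < n))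
  have ht : 0 < 5 / 2 * Real.log n / n := by positivity
  rw [mul_comm, ← le_div_iff₀ hn0]
  rcases le_or_gt n 7 with h7 | h7
  · refine supMoment_le_of_moment ht (p := 2) (by norm_num) ?_
    have := three_mul_sq_le_log hn h7
    simp only [show 2 * 2 = 4 by norm_num, integral_uniformSphere_coord_pow_four, Finset.sum_const,
      Finset.card_univ, Fintype.card_fin, nsmul_eq_mul]
    rw [div_pow, le_div_iff₀ (by positivity)]
    rw [show (n : ℝ) * (3 / (n * (n + 2))) * n ^ 2 = 3 * n ^ 2 / (n + 2) by field_simp,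
      div_le_iff₀ (by positivity)]
    exact this
  · have hl2 : 2 ≤ Real.log n := by
      rw [Real.le_log_iff_exp_le hn0]
      have h8 : (8 : ℝ) ≤ n := by exact_mod_cast h7
      have h2 : Real.exp 2 = Real.exp 1 ^ 2 := by rw [← Real.exp_nat_mul]; simp
      have h3 : Real.exp 1 ^ 2 ≤ 2.72 ^ 2 := by gcongr; linarith [Real.exp_one_lt_d9]
      rw [h2]; norm_num at h3; linarith
    have hm : 2 ≤ ⌊Real.log n⌋₊ := Nat.le_floor (by exact_mod_cast hl2)
    -- With p of order ln n the factor n = exp(ln n) from summing over coordinates is absorbed into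
    -- the p-th power. Here n ≥ 8 > e², so ⌊ln n⌋ ≥ 2.
    refine supMoment_le_of_moment ht (p := ⌊Real.log n⌋₊ + 1) (by omega) ?_
    have h1 := prod_odd_mul_exp_le' hm (Nat.floor_le hlog.le) (Nat.lt_floor_add_one _).le
    rw [Real.exp_log hn0] at h1
    calc _ ≤ ∑ i : Fin n, (∏ j ∈ Finset.range (⌊Real.log n⌋₊ + 1), (2 * j + 1 : ℝ)) /
            n ^ (⌊Real.log n⌋₊ + 1) :=
          Finset.sum_le_sum fun i _ => integral_uniformSphere_coord_pow_le i _
      _ = ((∏ j ∈ Finset.range (⌊Real.log n⌋₊ + 1), (2 * j + 1 : ℝ)) * n) /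
            n ^ (⌊Real.log n⌋₊ + 1) := by simp; ring
      _ ≤ _ := by rw [div_pow]; gcongr

end LogBound

/-! ### Regret of entropic dual averaging -/

section Regret

variable {n : ℕ}

/-- Hoeffding's lemma for finitely many weights. -/
theorem sum_mul_exp_le {p a : Fin n → ℝ} {G : ℝ} (hp : ∀ i, 0 ≤ p i) (hp1 : ∑ i, p i = 1)
    (ha : ∀ i, |a i| ≤ G) :
    ∑ i, p i * Real.exp (a i) ≤ Real.exp (∑ i, p i * a i + G ^ 2 / 2) := by
  let m : Measure (Fin n) := ∑ i, ENNReal.ofReal (p i) • Measure.dirac i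
  have hint : ∀ φ : Fin n → ℝ, ∫ i, φ i ∂m = ∑ i, p i * φ i := by
    intro φ
    rw [integral_finsetSum_measure]
    · simp [integral_smul_measure, ENNReal.toReal_ofReal (hp _)]
    · intro i _
      exact (integrable_dirac (by simp)).smul_measure ENNReal.ofReal_ne_top
  have hm : IsProbabilityMeasure m := by
    constructor
    simp only [m, Measure.coe_finsetSum, Finset.sum_apply, Measure.smul_apply, measure_univ,
      smul_eq_mul, mul_one]
    rw [← ENNReal.ofReal_sum_of_nonneg fun i _ => hp i, hp1, ENNReal.ofReal_one]
  have h := (hasSubgaussianMGF_of_mem_Icc (μ := m) (X := a) (a := -G) (b := G)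
    (measurable_of_finite a).aemeasurable (ae_of_all _ fun i => abs_le.1 (ha i))).mgf_le 1
  rw [mgf, hint, hint] at h
  have h2 : ∑ i, p i * Real.exp (1 * (a i - ∑ i, p i * a i)) =
      (∑ i, p i * Real.exp (a i)) * Real.exp (-∑ i, p i * a i) := by
    rw [Finset.sum_mul]
    refine Finset.sum_congr rfl fun i _ => ?_
    rw [mul_assoc, ← Real.exp_add]; ring_nf
  -- The sub-Gaussian parameter of a variable in [-G, G] is the squared half-length G².
  have h3 : (((‖G - -G‖₊ / 2) ^ 2 : NNReal) : ℝ) * 1 ^ 2 / 2 = G ^ 2 / 2 := by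
    push_cast
    rw [div_pow, Real.norm_eq_abs, sq_abs]; ring
  rw [h2, h3, Real.exp_neg, ← div_eq_mul_inv, div_le_iff₀ (Real.exp_pos _), ← Real.exp_add] at h
  rwa [add_comm] at h

/-- The dual potential of the entropy with parameter `β`. -/
def potential (β : ℝ) (s : Vec n) : ℝ :=
  β * Real.log ((1 / n) * ∑ i, Real.exp (-(1 / β) * s i))

variable [NeZero n]

theorem sum_exp_pos (β : ℝ) (s : Vec n) : 0 < ∑ i, Real.exp (-(1 / β) * s i) :=
  Finset.sum_pos (fun _ _ => Real.exp_pos _) Finset.univ_nonempty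

theorem mirror_mem_simplex (β : ℝ) (s : Vec n) : mirror β s ∈ simplex n := by
  refine ⟨fun i => div_nonneg (Real.exp_pos _).le (sum_exp_pos β s).le, ?_⟩
  simp only [mirror]
  rw [← Finset.sum_div, div_self (sum_exp_pos β s).ne']

theorem mem_simplex_nonempty : (simplex n).Nonempty := ⟨_, mirror_mem_simplex 1 0⟩

theorem potential_zero (β : ℝ) : potential β (0 : Vec n) = 0 := by
  have : (n : ℝ) ≠ 0 := Nat.cast_ne_zero.2 (NeZero.ne n)
  simp [potential, this]

/-- The change of potential is β times the log-moment generating function of -g/β under the weights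
`mirror β s`, so Hoeffding's lemma bounds it. -/
theorem potential_add_le {β : ℝ} (hβ : 0 < β) (s g : Vec n) {G : ℝ} (hG : ∀ i, |g i| ≤ G) :
    potential β (s + g) ≤ potential β s - inner ℝ g (mirror β s) + G ^ 2 / (2 * β) := by
  have hn : (0 : ℝ) < n := Nat.cast_pos.2 (NeZero.pos n)
  have hx := mirror_mem_simplex β s
  have hZ := sum_exp_pos β s
  have h1 := sum_mul_exp_le (p := fun i => mirror β s i) (a := fun i => -(1 / β) * g i)
    (G := G / β) hx.1 hx.2 (fun i => by
      rw [abs_mul, abs_neg, abs_of_pos (by positivity), one_div_mul_eq_div]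
      exact div_le_div_of_nonneg_right (hG i) hβ.le)
  have h2 : ∑ i, mirror β s i * Real.exp (-(1 / β) * g i) =
      (∑ i, Real.exp (-(1 / β) * (s + g) i)) / ∑ i, Real.exp (-(1 / β) * s i) := by
    rw [Finset.sum_div]
    refine Finset.sum_congr rfl fun i _ => ?_
    simp only [mirror, PiLp.add_apply]
    rw [mul_add, Real.exp_add]; ring
  have h3 : ∑ i, mirror β s i * (-(1 / β) * g i) = -(1 / β) * inner ℝ g (mirror β s) := by
    rw [PiLp.inner_apply, Finset.mul_sum]
    refine Finset.sum_congr rfl fun i _ => ?_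
    simp; ring
  rw [h2, h3, ← Real.log_le_iff_le_exp (div_pos (sum_exp_pos β _) hZ),
    Real.log_div (sum_exp_pos β _).ne' hZ.ne'] at h1
  have h4 := mul_le_mul_of_nonneg_left h1 hβ.le
  rw [potential, potential, Real.log_mul (by positivity) (sum_exp_pos β _).ne',
    Real.log_mul (by positivity) hZ.ne']
  have h5 : β * (-(1 / β) * inner ℝ g (mirror β s) + (G / β) ^ 2 / 2) =
      - inner ℝ g (mirror β s) + G ^ 2 / (2 * β) := by
    field_simp
  rw [h5] at h4
  linarith

/-- This is monotonicity of power means, with exponent β'/β ≥ 1. The normalisation 1/n in the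
potential is what makes it applicable. -/
theorem potential_antitone {β β' : ℝ} (hβ : 0 < β) (h : β ≤ β') (s : Vec n) :
    potential β' s ≤ potential β s := by
  have hn : (0 : ℝ) < n := Nat.cast_pos.2 (NeZero.pos n)
  have hβ' := hβ.trans_le h
  have hq : 1 ≤ β' / β := by rwa [one_le_div hβ]
  have h1 := Real.rpow_arith_mean_le_arith_mean_rpow Finset.univ (fun _ : Fin n => (1 / n : ℝ))
    (fun i => Real.exp (-(1 / β') * s i)) (fun _ _ => by positivity) (by simp [hn.ne'])
    (fun _ _ => (Real.exp_pos _).le) hq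
  rw [← Finset.mul_sum, ← Finset.mul_sum] at h1
  have h2 : ∀ i, Real.exp (-(1 / β') * s i) ^ (β' / β) = Real.exp (-(1 / β) * s i) := by
    intro i
    rw [← Real.exp_mul]; congr 1; field_simp
  simp_rw [h2] at h1
  have hp := mul_pos (one_div_pos.2 hn) (sum_exp_pos β' s)
  have h3 := Real.log_le_log (Real.rpow_pos_of_pos hp _) h1
  rw [Real.log_rpow hp] at h3
  have h4 := mul_le_mul_of_nonneg_left h3 hβ.le
  rw [potential, potential]
  calc _ = β * (β' / β * Real.log (1 / n * ∑ i, Real.exp (-(1 / β') * s i))) := by field_simp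
    _ ≤ _ := h4

/-- The logarithm of the sum of exponentials dominates each exponent, hence every convex combination
of them; the term β ln n pays for the normalisation. -/
theorem le_potential {β : ℝ} (hβ : 0 < β) (s : Vec n) {u : Vec n} (hu : u ∈ simplex n) :
    -inner ℝ s u - β * Real.log n ≤ potential β s := by
  have hn : (0 : ℝ) < n := Nat.cast_pos.2 (NeZero.pos n)
  have h1 : ∀ i, -(1 / β) * s i ≤ Real.log (∑ i, Real.exp (-(1 / β) * s i)) := fun i => by
    rw [Real.le_log_iff_exp_le (sum_exp_pos β s)]
    exact Finset.single_le_sum (f := fun i => Real.exp (-(1 / β) * s i))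
      (fun j _ => (Real.exp_pos _).le) (Finset.mem_univ i)
  have h2 : ∑ i, u i * (-(1 / β) * s i) ≤
      ∑ i, u i * Real.log (∑ i, Real.exp (-(1 / β) * s i)) :=
    Finset.sum_le_sum fun i _ => mul_le_mul_of_nonneg_left (h1 i) (hu.1 i)
  rw [← Finset.sum_mul, hu.2, one_mul] at h2
  have h3 : ∑ i, u i * (-(1 / β) * s i) = -(1 / β) * inner ℝ s u := by
    rw [PiLp.inner_apply, Finset.mul_sum]
    refine Finset.sum_congr rfl fun i _ => ?_
    simp; ring
  rw [h3] at h2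
  have h4 := mul_le_mul_of_nonneg_left h2 hβ.le
  rw [potential, Real.log_mul (by positivity) (sum_exp_pos β s).ne', one_div, Real.log_inv]
  have h5 : β * (-(1 / β) * inner ℝ s u) = -inner ℝ s u := by field_simp
  rw [h5] at h4
  linarith

/-- The regret bound for dual averaging with the entropy and increasing parameters. -/
theorem regret_le (S g : ℕ → Vec n) (hS0 : S 0 = 0) (hS : ∀ t, S (t + 1) = S t + g t)
    (β G : ℕ → ℝ) (hβ : ∀ t, 0 < β t) (hβm : Monotone β) (hG : ∀ t i, |g t i| ≤ G t)
    {u : Vec n} (hu : u ∈ simplex n) (N : ℕ) :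
    ∑ t ∈ Finset.range (N + 1), inner ℝ (g t) (mirror (β t) (S t) - u) ≤
      β N * Real.log n + ∑ t ∈ Finset.range (N + 1), G t ^ 2 / (2 * β t) := by
  have key : ∀ t, potential (β t) (S t) ≤
      ∑ k ∈ Finset.range t, (G k ^ 2 / (2 * β k) - inner ℝ (g k) (mirror (β k) (S k))) := by
    intro t
    induction t with
    | zero => simp [hS0, potential_zero]
    | succ t ih =>
      rw [Finset.sum_range_succ, hS]
      have h1 := potential_antitone (hβ t) (hβm (Nat.le_succ t)) (S t + g t)
      have h2 := potential_add_le (hβ t) (S t) (g t) (hG t)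
      simp only [Nat.succ_eq_add_one] at h1
      linarith
  have hSsum : ∀ t, S t = ∑ k ∈ Finset.range t, g k := by
    intro t
    induction t with
    | zero => simp [hS0]
    | succ t ih => rw [hS, ih, Finset.sum_range_succ]
  -- After the last estimate the parameter is not raised, so the bound contains β N rather than β
  -- (N+1).
  have h1 := potential_add_le (hβ N) (S N) (g N) (hG N)
  have h2 := le_potential (hβ N) (S N + g N) hu
  have h3 := key N
  rw [← hS, hSsum, sum_inner] at h2
  rw [← hS] at h1
  rw [hSsum (N + 1)] at h1
  simp_rw [inner_sub_right]
  rw [Finset.sum_sub_distrib, Finset.sum_range_succ (fun k => inner ℝ (g k) (mirror (β k) (S k))),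
    Finset.sum_range_succ (fun k => G k ^ 2 / (2 * β k))]
  rw [Finset.sum_sub_distrib] at h3
  linarith

end Regret

/-! ### Deterministic estimates for one smooth convex function near the simplex -/

section Neighbourhood

variable {n : ℕ} {μ₀ : ℝ}

theorem isCompact_simplex : IsCompact (simplex n) := by
  have h : simplex n = WithLp.toLp 2 '' stdSimplex ℝ (Fin n) := by
    ext x
    constructor
    · intro hx
      exact ⟨WithLp.ofLp x, hx, rfl⟩
    · rintro ⟨y, hy, rfl⟩
      exact hy
  rw [h]
  exact (isCompact_stdSimplex ℝ (Fin n)).image (PiLp.continuous_toLp 2 _)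

theorem convex_simplex : Convex ℝ (simplex n) := by
  intro x hx y hy a b ha hb hab
  refine ⟨fun i => ?_, ?_⟩
  · have := hx.1 i
    have := hy.1 i
    simp only [PiLp.add_apply, PiLp.smul_apply, smul_eq_mul]
    positivity
  · simp only [PiLp.add_apply, PiLp.smul_apply, smul_eq_mul, Finset.sum_add_distrib,
      ← Finset.mul_sum, hx.2, hy.2, mul_one, hab]

theorem add_mem_closedNhd {x u : Vec n} (hx : x ∈ simplex n) (hu : ‖u‖ ≤ μ₀) :
    x + u ∈ closedNhd n μ₀ :=
  mem_cthickening_of_dist_le _ x _ _ hx (by simpa [dist_eq_norm] using hu)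

theorem add_mem_openNhd {x u : Vec n} (hx : x ∈ simplex n) (hu : ‖u‖ < μ₀) :
    x + u ∈ openNhd n μ₀ :=
  mem_thickening_iff.2 ⟨x, hx, by simpa [dist_eq_norm] using hu⟩

theorem openNhd_subset_closedNhd : openNhd n μ₀ ⊆ closedNhd n μ₀ :=
  thickening_subset_cthickening _ _

theorem isOpen_openNhd : IsOpen (openNhd n μ₀) := isOpen_thickening

theorem simplex_subset_closedNhd : simplex n ⊆ closedNhd n μ₀ := self_subset_cthickening _

end Neighbourhood

/-- A function on the closed neighbourhood of the simplex that is Lipschitz and convex, and has a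
Lipschitz gradient on the open neighbourhood. -/
structure SmoothConvex {n : ℕ} (μ₀ : ℝ) (φ : Vec n → ℝ) (K L : ℝ) : Prop where
  convex : ConvexOn ℝ (closedNhd n μ₀) φ
  lipschitz : ∀ x ∈ closedNhd n μ₀, ∀ y ∈ closedNhd n μ₀, |φ x - φ y| ≤ K * ‖x - y‖
  differentiable : ∀ x ∈ openNhd n μ₀, DifferentiableAt ℝ φ x
  gradient_lipschitz : ∀ x ∈ openNhd n μ₀, ∀ y ∈ openNhd n μ₀,
    ‖gradient φ x - gradient φ y‖ ≤ L * ‖x - y‖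

namespace SmoothConvex

variable {n : ℕ} {μ₀ : ℝ} {φ : Vec n → ℝ} {K L : ℝ}

theorem continuousOn (h : SmoothConvex μ₀ φ K L) : ContinuousOn φ (closedNhd n μ₀) := by
  have : LipschitzOnWith (Real.toNNReal K) φ (closedNhd n μ₀) := by
    refine LipschitzOnWith.of_dist_le_mul fun x hx y hy => ?_
    rw [Real.dist_eq, dist_eq_norm]
    exact (h.lipschitz x hx y hy).trans (by gcongr; exact Real.le_coe_toNNReal K)
  exact this.continuousOn

theorem hasDerivAt_line (h : SmoothConvex μ₀ φ K L) {x v : Vec n} {t : ℝ}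
    (ht : x + t • v ∈ openNhd n μ₀) :
    HasDerivAt (fun s : ℝ => φ (x + s • v)) (inner ℝ (gradient φ (x + t • v)) v) t := by
  have h1 : HasDerivAt (fun s : ℝ => x + s • v) v t := by
    simpa using ((hasDerivAt_id t).smul_const v).const_add x
  have h2 := (h.differentiable _ ht).hasGradientAt.hasFDerivAt.comp_hasDerivAt t h1
  simpa [Function.comp_def] using h2

theorem norm_gradient_le (h : SmoothConvex μ₀ φ K L) (hK : 0 ≤ K) {x : Vec n}
    (hx : x ∈ openNhd n μ₀) : ‖gradient φ x‖ ≤ K := by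
  have h1 := (h.differentiable _ hx).hasGradientAt.hasFDerivAt.le_of_lip' hK (by
    filter_upwards [isOpen_openNhd.mem_nhds hx] with y hy
    exact h.lipschitz y (openNhd_subset_closedNhd hy) x (openNhd_subset_closedNhd hx))
  rwa [LinearIsometryEquiv.norm_map] at h1

theorem inner_gradient_le (h : SmoothConvex μ₀ φ K L) {p q : Vec n} (hp : p ∈ openNhd n μ₀)
    (hq : q ∈ closedNhd n μ₀) : inner ℝ (gradient φ p) (q - p) ≤ φ q - φ p := by
  have h1 := h.convex.comp_affineMap (AffineMap.lineMap (k := ℝ) p q)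
  have h2 : HasDerivAt (φ ∘ AffineMap.lineMap (k := ℝ) p q) (inner ℝ (gradient φ p) (q - p)) 0 := by
    have := h.hasDerivAt_line (x := p) (v := q - p) (t := 0) (by simpa using hp)
    simp only [zero_smul, add_zero] at this
    refine this.congr_of_eventuallyEq (Eventually.of_forall fun t => ?_)
    simp [AffineMap.lineMap_apply, add_comm]
  have := h1.le_slope_of_hasDerivAt (x := 0) (y := 1)
    (by simpa using openNhd_subset_closedNhd hp) (by simpa using hq) one_pos h2
  simpa [slope_def_field] using this

theorem abs_sub_linear_le (h : SmoothConvex μ₀ φ K L) (hμ₀ : 0 < μ₀) {x u : Vec n}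
    (hx : x ∈ simplex n) (hu : ‖u‖ ≤ μ₀) :
    |φ (x + u) - φ x - inner ℝ (gradient φ x) u| ≤ L / 2 * ‖u‖ ^ 2 := by
  let w : ℝ → ℝ := fun t => φ (x + t • u) - φ x - t * inner ℝ (gradient φ x) u
  have hxo : x ∈ openNhd n μ₀ := by simpa using add_mem_openNhd (u := 0) hx (by simpa using hμ₀)
  have hopen : ∀ t ∈ Ico (0 : ℝ) 1, x + t • u ∈ openNhd n μ₀ := by
    intro t ht
    refine add_mem_openNhd hx ?_
    rw [norm_smul, Real.norm_of_nonneg ht.1]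
    nlinarith [ht.1, ht.2, norm_nonneg u]
  have hclosed : ∀ t ∈ Icc (0 : ℝ) 1, x + t • u ∈ closedNhd n μ₀ := by
    intro t ht
    refine add_mem_closedNhd hx ?_
    rw [norm_smul, Real.norm_of_nonneg ht.1]
    nlinarith [ht.1, ht.2, norm_nonneg u]
  have hd : ∀ t ∈ Ico (0 : ℝ) 1, HasDerivAt w
      (inner ℝ (gradient φ (x + t • u)) u - inner ℝ (gradient φ x) u) t := by
    intro t ht
    have := ((h.hasDerivAt_line (hopen t ht)).sub_const (φ x)).fun_sub
      ((hasDerivAt_id t).mul_const (inner ℝ (gradient φ x) u))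
    simpa [w] using this
  have hB : ∀ t : ℝ, HasDerivAt (fun t => L / 2 * ‖u‖ ^ 2 * t ^ 2) (L * ‖u‖ ^ 2 * t) t := by
    intro t
    refine ((hasDerivAt_pow 2 t).const_mul (L / 2 * ‖u‖ ^ 2)).congr_deriv ?_
    push_cast; ring
  -- At t = 1 the point may lie on the boundary, where no gradient is available. Derivatives on [0,
  -- 1) and continuity on [0, 1] suffice.
  have := image_norm_le_of_norm_deriv_right_le_deriv_boundary (f := w) (a := 0) (b := 1)
    (f' := fun t => inner ℝ (gradient φ (x + t • u)) u - inner ℝ (gradient φ x) u)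
    ?_ (fun t ht => (hd t ht).hasDerivWithinAt) (by simp [w]) hB ?_ (right_mem_Icc.2 zero_le_one)
  · simpa [w] using this
  · refine ((h.continuousOn.comp (by fun_prop) hclosed).sub continuousOn_const).sub (by fun_prop)
  · intro t ht
    rw [← inner_sub_left]
    refine (norm_inner_le_norm _ _).trans ?_
    have := h.gradient_lipschitz _ (hopen t ht) _ hxo
    rw [add_sub_cancel_left, norm_smul, Real.norm_of_nonneg ht.1] at this
    calc _ ≤ L * (t * ‖u‖) * ‖u‖ := by gcongr
      _ = _ := by ring

theorem second_moment_le [NeZero n] (h : SmoothConvex μ₀ φ K L) {μ δ : ℝ} (hK : 0 ≤ K)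
    (hδ : 0 ≤ δ) (hμ : 0 < μ) (hμμ₀ : μ ≤ μ₀) {x : Vec n} (hx : x ∈ simplex n) :
    ∫ e, (n / μ) ^ 2 * supNorm e ^ 2 * (|φ (x + μ • e) - φ x| + 2 * δ) ^ 2 ∂uniformSphere n ≤
      n * supMoment n * (7 / 5 * K ^ 2 + 7 * n * (L ^ 2 * μ ^ 2 / 4 + 4 * δ ^ 2 / μ ^ 2)) := by
  have hμ₀ := hμ.trans_le hμμ₀
  have hxo : x ∈ openNhd n μ₀ := by simpa using add_mem_openNhd (u := 0) hx (by simpa using hμ₀)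
  have hn : (0 : ℝ) < n := Nat.cast_pos.2 (NeZero.pos n)
  set s := gradient φ x
  set r := 7 * (L ^ 2 * μ ^ 2 / 4 + 4 * δ ^ 2 / μ ^ 2)
  have hi1 : Integrable (fun e : Vec n => 7 / 5 * n ^ 2 * (inner ℝ s e ^ 2 * supNorm e ^ 2))
      (uniformSphere n) := integrable_uniformSphere
    (continuous_const.mul (((by fun_prop : Continuous fun e : Vec n => inner ℝ s e ^ 2)).mul
      (continuous_supNorm.pow 2)))
  have hi2 : Integrable (fun e : Vec n => n ^ 2 * r * supNorm e ^ 2) (uniformSphere n) :=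
    integrable_uniformSphere (continuous_const.mul (continuous_supNorm.pow 2))
  have hle : ∀ᵐ e ∂uniformSphere n,
      (n / μ) ^ 2 * supNorm e ^ 2 * (|φ (x + μ • e) - φ x| + 2 * δ) ^ 2 ≤
        7 / 5 * n ^ 2 * (inner ℝ s e ^ 2 * supNorm e ^ 2) + n ^ 2 * r * supNorm e ^ 2 := by
    filter_upwards [ae_norm_eq_one] with e he
    have hn1 : ‖μ • e‖ = μ := by rw [norm_smul, he, mul_one, Real.norm_of_nonneg hμ.le]
    have h1 := h.abs_sub_linear_le hμ₀ hx (u := μ • e) (by rw [hn1]; exact hμμ₀)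
    rw [hn1, inner_smul_right] at h1
    set A := φ (x + μ • e) - φ x
    set B := inner ℝ s e
    have h2 : |A| ≤ μ * |B| + L / 2 * μ ^ 2 := by
      have := abs_sub_abs_le_abs_sub A (μ * B)
      rw [abs_mul μ, abs_of_pos hμ] at this
      linarith
    have h3 : (|A| + 2 * δ) ^ 2 ≤ μ ^ 2 * (7 / 5 * B ^ 2 + r) := by
      have hr : μ ^ 2 * r = 7 * ((L / 2 * μ ^ 2) ^ 2 + (2 * δ) ^ 2) := by
        simp only [r]; field_simp; ring
      have h0 := abs_nonneg A
      rw [mul_add, hr]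
      have hB : B ^ 2 = |B| ^ 2 := (sq_abs B).symm
      rw [hB]
      have h5 : (|A| + 2 * δ) ^ 2 ≤ (μ * |B| + L / 2 * μ ^ 2 + 2 * δ) ^ 2 := by gcongr
      refine h5.trans ?_
      -- (a+b)² ≤ (7/5)a² + (7/2)b² with a the linear part, then b² ≤ 2(c²+d²) for smoothness error
      -- and noise. The weight 7/5 later leaves room below 2.
      nlinarith [sq_nonneg (2 / 5 * (μ * |B|) - (L / 2 * μ ^ 2 + 2 * δ)),
        sq_nonneg (L / 2 * μ ^ 2 - 2 * δ)]
    calc _ ≤ (n / μ) ^ 2 * supNorm e ^ 2 * (μ ^ 2 * (7 / 5 * B ^ 2 + r)) := by gcongr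
      _ = _ := by field_simp
  refine (integral_mono_of_nonneg (ae_of_all _ fun e => by positivity) (hi1.add hi2) hle).trans ?_
  simp only [Pi.add_apply]
  rw [integral_add hi1 hi2, integral_const_mul, integral_const_mul, integral_inner_sq_supNorm,
    ← supMoment_eq]
  have hs : ‖s‖ ^ 2 ≤ K ^ 2 := by
    have := h.norm_gradient_le hK hxo
    gcongr
  have ha := supMoment_nonneg (n := n)
  calc _ = n * supMoment n * (7 / 5 * ‖s‖ ^ 2 + n * r) := by field_simp
    _ ≤ n * supMoment n * (7 / 5 * K ^ 2 + n * r) := by gcongr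
    _ = _ := by simp only [r]; ring

theorem integral_ball_neg (g : Vec n → ℝ) :
    ∫ u in ball (0 : Vec n) 1, g (-u) = ∫ u in ball (0 : Vec n) 1, g u := by
  rw [← integral_indicator measurableSet_ball, ← integral_indicator measurableSet_ball,
    ← integral_neg_eq_self ((ball (0 : Vec n) 1).indicator g)]
  congr 1
  ext u
  by_cases hu : ‖u‖ < 1 <;> simp [indicator, hu]

theorem smul_mem_nhd {μ : ℝ} (hμ : 0 < μ) (hμμ₀ : μ ≤ μ₀) {x u : Vec n} (hx : x ∈ simplex n)
    (hu : ‖u‖ < 1) : x + μ • u ∈ openNhd n μ₀ := by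
  refine add_mem_openNhd hx ?_
  rw [norm_smul, Real.norm_of_nonneg hμ.le]
  nlinarith

theorem smul_mem_closedNhd {μ : ℝ} (hμ : 0 < μ) (hμμ₀ : μ ≤ μ₀) {x u : Vec n} (hx : x ∈ simplex n)
    (hu : ‖u‖ ≤ 1) : x + μ • u ∈ closedNhd n μ₀ := by
  refine add_mem_closedNhd hx ?_
  rw [norm_smul, Real.norm_of_nonneg hμ.le]
  nlinarith

theorem integrableOn_ball (h : SmoothConvex μ₀ φ K L) {μ : ℝ} (hμ : 0 < μ) (hμμ₀ : μ ≤ μ₀)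
    {x : Vec n} (hx : x ∈ simplex n) :
    IntegrableOn (fun u => φ (x + μ • u)) (ball (0 : Vec n) 1) := by
  have h1 : ContinuousOn (fun u => φ (x + μ • u)) (closedBall (0 : Vec n) 1) :=
    h.continuousOn.comp (by fun_prop) fun u hu => smul_mem_closedNhd hμ hμμ₀ hx (by simpa using hu)
  exact (h1.integrableOn_compact (isCompact_closedBall _ _)).mono_set ball_subset_closedBall

theorem integrableOn_ball_neg (h : SmoothConvex μ₀ φ K L) {μ : ℝ} (hμ : 0 < μ) (hμμ₀ : μ ≤ μ₀)
    {x : Vec n} (hx : x ∈ simplex n) :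
    IntegrableOn (fun u => φ (x + μ • (-u))) (ball (0 : Vec n) 1) := by
  have h1 : ContinuousOn (fun u => φ (x + μ • (-u))) (closedBall (0 : Vec n) 1) :=
    h.continuousOn.comp (by fun_prop) fun u hu => smul_mem_closedNhd hμ hμμ₀ hx (by simpa using hu)
  exact (h1.integrableOn_compact (isCompact_closedBall _ _)).mono_set ball_subset_closedBall

/-- Pairing u with -u serves both directions: midpoint convexity gives the lower bound for the mean,
and cancellation of the linear terms gives the quadratic upper bound. -/
theorem integral_ball_eq_half (h : SmoothConvex μ₀ φ K L) {μ : ℝ} (hμ : 0 < μ) (hμμ₀ : μ ≤ μ₀)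
    {x : Vec n} (hx : x ∈ simplex n) :
    ∫ u in ball (0 : Vec n) 1, φ (x + μ • u) =
      ∫ u in ball (0 : Vec n) 1, (φ (x + μ • u) + φ (x + μ • (-u))) / 2 := by
  have h1 := h.integrableOn_ball hμ hμμ₀ hx
  have h2 := h.integrableOn_ball_neg hμ hμμ₀ hx
  rw [integral_div, integral_add h1 h2, integral_ball_neg (fun u => φ (x + μ • u))]
  ring

theorem integral_ball_const (c : ℝ) : ∫ _ in ball (0 : Vec n) 1, c = ballVolume n * c := by
  rw [setIntegral_const, smul_eq_mul, ballVolume]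

theorem le_integral_ball (h : SmoothConvex μ₀ φ K L) {μ : ℝ} (hμ : 0 < μ) (hμμ₀ : μ ≤ μ₀)
    {x : Vec n} (hx : x ∈ simplex n) :
    ballVolume n * φ x ≤ ∫ u in ball (0 : Vec n) 1, φ (x + μ • u) := by
  have h1 := h.integrableOn_ball hμ hμμ₀ hx
  have h2 := h.integrableOn_ball_neg hμ hμμ₀ hx
  rw [h.integral_ball_eq_half hμ hμμ₀ hx, ← integral_ball_const]
  refine setIntegral_mono_on (integrableOn_const measure_ball_lt_top.ne) ((h1.add h2).div_const 2)
    measurableSet_ball fun u hu => ?_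
  have hu' : ‖u‖ ≤ 1 := by simpa using (mem_ball_zero_iff.1 hu).le
  obtain ⟨-, hconv⟩ := h.convex
  have := hconv (smul_mem_closedNhd hμ hμμ₀ hx hu')
    (smul_mem_closedNhd hμ hμμ₀ hx (u := -u) (by simpa using hu'))
    (a := 1 / 2) (b := 1 / 2) (by norm_num) (by norm_num) (by norm_num)
  have hc : (1 / 2 : ℝ) • (x + μ • u) + (1 / 2 : ℝ) • (x + μ • -u) = x := by
    module
  rw [hc] at this
  simp only [smul_eq_mul] at this
  linarith

theorem integral_ball_le (h : SmoothConvex μ₀ φ K L) {μ : ℝ} (hK : 0 ≤ K) (hL : 0 ≤ L)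
    (hμ : 0 < μ) (hμμ₀ : μ ≤ μ₀) {x : Vec n} (hx : x ∈ simplex n) :
    ∫ u in ball (0 : Vec n) 1, φ (x + μ • u) ≤
      ballVolume n * (φ x + min (K * μ) (L / 2 * μ ^ 2)) := by
  have h1 := h.integrableOn_ball hμ hμμ₀ hx
  have h2 := h.integrableOn_ball_neg hμ hμμ₀ hx
  rw [h.integral_ball_eq_half hμ hμμ₀ hx, ← integral_ball_const]
  refine setIntegral_mono_on ((h1.add h2).div_const 2) (integrableOn_const measure_ball_lt_top.ne)
    measurableSet_ball fun u hu => ?_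
  have hu' : ‖u‖ ≤ 1 := by simpa using (mem_ball_zero_iff.1 hu).le
  have hxc : x ∈ closedNhd n μ₀ := simplex_subset_closedNhd hx
  have key : ∀ w : Vec n, ‖w‖ ≤ 1 → ‖μ • w‖ ≤ μ := fun w hw => by
    rw [norm_smul, Real.norm_of_nonneg hμ.le]; nlinarith
  have hl : ∀ w : Vec n, ‖w‖ ≤ 1 → φ (x + μ • w) ≤ φ x + K * μ := fun w hw => by
    have h3 := h.lipschitz _ (smul_mem_closedNhd hμ hμμ₀ hx hw) x hxc
    rw [add_sub_cancel_left] at h3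
    have h4 : K * ‖μ • w‖ ≤ K * μ := by gcongr; exact key w hw
    linarith [le_abs_self (φ (x + μ • w) - φ x)]
  have hq : ∀ w : Vec n, ‖w‖ ≤ 1 →
      φ (x + μ • w) ≤ φ x + inner ℝ (gradient φ x) (μ • w) + L / 2 * μ ^ 2 := fun w hw => by
    have h3 := h.abs_sub_linear_le (hμ.trans_le hμμ₀) hx (u := μ • w) ((key w hw).trans hμμ₀)
    have h4 : L / 2 * ‖μ • w‖ ^ 2 ≤ L / 2 * μ ^ 2 := by gcongr; exact key w hw
    linarith [le_abs_self (φ (x + μ • w) - φ x - inner ℝ (gradient φ x) (μ • w))]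
  have hneg : ‖-u‖ ≤ 1 := by simpa using hu'
  have hl1 := hl u hu'
  have hl2 := hl (-u) hneg
  have hq1 := hq u hu'
  have hq2 := hq (-u) hneg
  rw [smul_neg, inner_neg_right] at hq2
  rw [smul_neg] at hl2
  simp only [smul_neg]
  rcases min_choice (K * μ) (L / 2 * μ ^ 2) with hm | hm <;> rw [hm] <;> linarith

/-- The right side is the ball mean of ⟨∇φ(x+μu), x-y⟩, which convexity bounds below by the mean of
φ(x+μu) - φ(y+μu). Smoothing can only raise the value at x, so the bias arises at y alone. -/
theorem first_moment_ge [NeZero n] (h : SmoothConvex μ₀ φ K L) {μ : ℝ} (hK : 0 ≤ K) (hL : 0 ≤ L)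
    (hμ : 0 < μ) (hμμ₀ : μ ≤ μ₀) {x y : Vec n} (hx : x ∈ simplex n) (hy : y ∈ simplex n) :
    φ x - φ y - min (K * μ) (L / 2 * μ ^ 2) ≤
      n / μ * ∫ e, φ (x + μ • e) * inner ℝ e (x - y) ∂uniformSphere n := by
  have hlip : LipschitzOnWith (Real.toNNReal (K * μ)) (fun u => φ (x + μ • u))
      (closedBall (0 : Vec n) 1) := by
    refine LipschitzOnWith.of_dist_le_mul fun u hu w hw => ?_
    rw [Real.coe_toNNReal _ (by positivity), Real.dist_eq, dist_eq_norm]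
    refine (h.lipschitz _ (smul_mem_closedNhd hμ hμμ₀ hx (by simpa using hu)) _
      (smul_mem_closedNhd hμ hμμ₀ hx (by simpa using hw))).trans_eq ?_
    rw [add_sub_add_left_eq_sub, ← smul_sub, norm_smul, Real.norm_of_nonneg hμ.le, mul_assoc]
  have hD := integral_ball_eq_uniformSphere hlip (x - y)
    (F' := fun u => μ * inner ℝ (gradient φ (x + μ • u)) (x - y)) (fun u hu => by
      have h0 := smul_mem_nhd hμ hμμ₀ hx (mem_ball_zero_iff.1 hu)
      have := h.hasDerivAt_line (x := x + μ • u) (v := μ • (x - y)) (t := 0) (by simpa using h0)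
      simp only [zero_smul, add_zero, inner_smul_right] at this
      refine this.congr_of_eventuallyEq (Eventually.of_forall fun t => ?_)
      simp only [smul_add, add_assoc, smul_comm t μ])
  rw [integral_const_mul] at hD
  have hV := ballVolume_pos (n := n)
  have hgc : ContinuousOn (gradient φ) (openNhd n μ₀) := by
    have : LipschitzOnWith (Real.toNNReal L) (gradient φ) (openNhd n μ₀) := by
      refine LipschitzOnWith.of_dist_le_mul fun p hp q hq => ?_
      rw [dist_eq_norm, dist_eq_norm, Real.coe_toNNReal _ hL]
      exact h.gradient_lipschitz p hp q hq
    exact this.continuousOn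
  have hgi : IntegrableOn (fun u => inner ℝ (gradient φ (x + μ • u)) (x - y))
      (ball (0 : Vec n) 1) := by
    have hc : ContinuousOn (fun u => inner ℝ (gradient φ (x + μ • u)) (x - y))
        (ball (0 : Vec n) 1) :=
      (hgc.comp (by fun_prop) fun u hu =>
        smul_mem_nhd hμ hμμ₀ hx (mem_ball_zero_iff.1 hu)).inner continuousOn_const
    refine ⟨hc.aestronglyMeasurable measurableSet_ball,
      .restrict_of_bounded (C := K * ‖x - y‖) measure_ball_lt_top ?_⟩
    · filter_upwards [ae_restrict_mem measurableSet_ball] with u hu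
      refine (norm_inner_le_norm _ _).trans ?_
      gcongr
      exact h.norm_gradient_le hK (smul_mem_nhd hμ hμμ₀ hx (mem_ball_zero_iff.1 hu))
  have hmono : ∫ u in ball (0 : Vec n) 1, (φ (x + μ • u) - φ (y + μ • u)) ≤
      ∫ u in ball (0 : Vec n) 1, inner ℝ (gradient φ (x + μ • u)) (x - y) := by
    refine setIntegral_mono_on ((h.integrableOn_ball hμ hμμ₀ hx).sub
      (h.integrableOn_ball hμ hμμ₀ hy)) hgi measurableSet_ball fun u hu => ?_
    have hu' := mem_ball_zero_iff.1 hu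
    have := h.inner_gradient_le (smul_mem_nhd hμ hμμ₀ hx hu')
      (openNhd_subset_closedNhd (smul_mem_nhd hμ hμμ₀ hy hu'))
    rw [add_sub_add_right_eq_sub, ← neg_sub x y, inner_neg_right] at this
    linarith
  rw [integral_sub (h.integrableOn_ball hμ hμμ₀ hx) (h.integrableOn_ball hμ hμμ₀ hy)] at hmono
  have h1 := h.le_integral_ball hμ hμμ₀ hx
  have h2 := h.integral_ball_le hK hL hμ hμμ₀ hy
  have h3 : ballVolume n * (φ x - φ y - min (K * μ) (L / 2 * μ ^ 2)) ≤
      ballVolume n * (n / μ * ∫ e, φ (x + μ • e) * inner ℝ e (x - y) ∂uniformSphere n) := by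
    have h4 : ballVolume n * (n / μ * ∫ e, φ (x + μ • e) * inner ℝ e (x - y) ∂uniformSphere n) =
        ∫ u in ball (0 : Vec n) 1, inner ℝ (gradient φ (x + μ • u)) (x - y) := by
      rw [← mul_right_inj' hμ.ne', hD]; field_simp
    rw [h4]; linarith
  exact le_of_mul_le_mul_left h3 hV

end SmoothConvex

/-! ### The random function: measurable version and expectation -/

theorem integral_le_rms {H : Type*} [MeasurableSpace H] {ν : Measure H} [IsProbabilityMeasure ν]
    {K : H → ℝ} (hK : MemLp K 2 ν) : ∫ h, K h ∂ν ≤ rms ν K := by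
  have h1 := variance_nonneg K ν
  rw [variance_eq_sub hK] at h1
  refine Real.le_sqrt_of_sq_le ?_
  simp only [Pi.pow_apply] at h1
  linarith

theorem sq_rms {H : Type*} [MeasurableSpace H] {ν : Measure H} {K : H → ℝ} :
    rms ν K ^ 2 = ∫ h, K h ^ 2 ∂ν :=
  Real.sq_sqrt (integral_nonneg fun _ => sq_nonneg _)

/-- A random function that is almost surely Lipschitz on a set has a jointly measurable version. -/
theorem exists_measurable_version {X H : Type*} [PseudoMetricSpace X] [SecondCountableTopology X]
    [MeasurableSpace X] [BorelSpace X] [MeasurableSpace H] {ν : Measure H} {S : Set X}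
    (hS : S.Nonempty) {f : X → H → ℝ} {K : H → ℝ} (hf : ∀ x ∈ S, AEMeasurable (f x) ν)
    (hK : AEMeasurable K ν)
    (hlip : ∀ᵐ h ∂ν, ∀ x ∈ S, ∀ y ∈ S, |f x h - f y h| ≤ K h * dist x y) :
    ∃ g : X → H → ℝ, Measurable (Function.uncurry g) ∧ ∀ᵐ h ∂ν, ∀ x ∈ S, g x h = f x h := by
  have := hS.to_subtype
  let d : ℕ → S := TopologicalSpace.denseSeq S
  have hd : DenseRange d := TopologicalSpace.denseRange_denseSeq S
  let m : ℕ → H → ℝ := fun k => (hf (d k) (d k).2).mk (f (d k))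
  -- McShane's formula over a countable dense set: each term is jointly measurable, and almost
  -- surely on S the infimum reproduces f.
  refine ⟨fun x h => ⨅ k, (m k h + hK.mk K h * dist x (d k)), ?_, ?_⟩
  · refine Measurable.iInf fun k => ?_
    have h1 : Measurable (m k) := (hf (d k) (d k).2).measurable_mk
    have h2 : Measurable (hK.mk K) := hK.measurable_mk
    exact (h1.comp measurable_snd).add
      ((h2.comp measurable_snd).mul (measurable_fst.dist measurable_const))
  · filter_upwards [hlip, hK.ae_eq_mk, ae_all_iff.2 fun k => (hf (d k) (d k).2).ae_eq_mk]
      with h hl hKh hm x hx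
    have hval : ∀ k, m k h + hK.mk K h * dist x (d k) = f (d k) h + K h * dist x (d k) :=
      fun k => by rw [← hKh]; simp only [m]; rw [← hm k]
    simp_rw [hval]
    have hlow : ∀ k, f x h ≤ f (d k) h + K h * dist x (d k) := fun k => by
      linarith [le_abs_self (f x h - f (d k) h), hl x hx (d k) (d k).2]
    refine le_antisymm (le_of_forall_pos_le_add fun ε hε => ?_) (le_ciInf hlow)
    -- The k-th term exceeds f x h by at most 2|K h| times the distance; the added 1 keeps the
    -- denominator positive.
    obtain ⟨k, hk⟩ := hd.exists_dist_lt ⟨x, hx⟩ (show 0 < ε / (2 * |K h| + 1) by positivity)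
    refine (ciInf_le ⟨f x h, by rintro _ ⟨k, rfl⟩; exact hlow k⟩ k).trans ?_
    have h1 := hl (d k) (d k).2 x hx
    rw [dist_comm] at h1
    have hk' : dist x (d k) < ε / (2 * |K h| + 1) := hk
    rw [lt_div_iff₀ (by positivity)] at hk'
    have h2 : K h * dist x (d k) ≤ |K h| * dist x (d k) := by gcongr; exact le_abs_self _
    linarith [le_abs_self (f (d k) h - f x h), dist_nonneg (x := x) (y := (d k : X))]

namespace SmoothSetting

variable {n : ℕ} [NeZero n] {H : Type*} [MeasurableSpace H] {ν : Measure H}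
  [IsProbabilityMeasure ν] {μ₀ : ℝ} {f : Vec n → H → ℝ} {K L : H → ℝ}

theorem smoothConvex (hf : SmoothSetting ν μ₀ f K L) :
    ∀ᵐ h ∂ν, SmoothConvex μ₀ (fun x => f x h) (K h) (L h) := by
  filter_upwards [hf.convex, hf.lipschitz, hf.differentiable, hf.gradient_lipschitz] with h h1 h2 h3 h4
  exact ⟨h1, h2, h3, h4⟩

theorem exists_ne_mem_openNhd (hμ₀ : 0 < μ₀) :
    ∃ x ∈ openNhd n μ₀, ∃ y ∈ openNhd n μ₀, 0 < ‖x - y‖ := by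
  obtain ⟨x, hx⟩ := mem_simplex_nonempty (n := n)
  refine ⟨x + (EuclideanSpace.single 0 (μ₀ / 2)), add_mem_openNhd hx ?_, x + 0,
    add_mem_openNhd hx (by simpa using hμ₀), ?_⟩
  · simp [abs_of_pos hμ₀]; linarith
  · simp [hμ₀.ne']

theorem K_nonneg (hf : SmoothSetting ν μ₀ f K L) (hμ₀ : 0 < μ₀) : ∀ᵐ h ∂ν, 0 ≤ K h := by
  obtain ⟨x, hx, y, hy, hxy⟩ := exists_ne_mem_openNhd (n := n) hμ₀
  filter_upwards [hf.lipschitz] with h hl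
  have := (abs_nonneg _).trans
    (hl x (openNhd_subset_closedNhd hx) y (openNhd_subset_closedNhd hy))
  exact nonneg_of_mul_nonneg_left this hxy

theorem objective_smoothConvex (hf : SmoothSetting ν μ₀ f K L) :
    SmoothConvex μ₀ (objective ν f) (rms ν K) (rms ν L) where
  convex := by
    obtain ⟨h, hh⟩ := hf.convex.exists
    refine ⟨hh.1, fun x hx y hy a b ha hb hab => ?_⟩
    have hix := hf.integrable x hx
    have hiy := hf.integrable y hy
    simp only [objective, smul_eq_mul]
    rw [← integral_const_mul, ← integral_const_mul,
      ← integral_add (hix.const_mul a) (hiy.const_mul b)]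
    refine integral_mono_ae (hf.integrable _ (hh.1 hx hy ha hb hab))
      ((hix.const_mul a).add (hiy.const_mul b)) ?_
    filter_upwards [hf.convex] with h' hc
    exact hc.2 hx hy ha hb hab
  lipschitz x hx y hy := by
    have hKi := hf.lipschitz_memLp.integrable one_le_two
    rw [objective, objective, ← integral_sub (hf.integrable x hx) (hf.integrable y hy),
      ← Real.norm_eq_abs]
    refine (norm_integral_le_of_norm_le (hKi.mul_const ‖x - y‖) ?_).trans ?_
    · filter_upwards [hf.lipschitz] with h hl using hl x hx y hy
    · rw [integral_mul_const]
      gcongr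
      exact integral_le_rms hf.lipschitz_memLp
  differentiable x hx := (hf.gradient_expectation x hx).2.differentiableAt
  gradient_lipschitz x hx y hy := by
    have hLi := hf.gradient_lipschitz_memLp.integrable one_le_two
    obtain ⟨hix, hgx⟩ := hf.gradient_expectation x hx
    obtain ⟨hiy, hgy⟩ := hf.gradient_expectation y hy
    rw [hgx.gradient, hgy.gradient, ← integral_sub hix hiy]
    refine (norm_integral_le_of_norm_le (hLi.mul_const ‖x - y‖) ?_).trans ?_
    · filter_upwards [hf.gradient_lipschitz] with h hl using hl x hx y hy
    · rw [integral_mul_const]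
      gcongr
      exact integral_le_rms hf.gradient_lipschitz_memLp

theorem exists_measurable (hf : SmoothSetting ν μ₀ f K L) :
    ∃ g : Vec n → H → ℝ, Measurable (Function.uncurry g) ∧
      ∀ᵐ h ∂ν, ∀ x ∈ closedNhd n μ₀, g x h = f x h := by
  refine exists_measurable_version (mem_simplex_nonempty.mono simplex_subset_closedNhd)
    (fun x hx => (hf.integrable x hx).aemeasurable) hf.lipschitz_memLp.aestronglyMeasurable.aemeasurable ?_
  filter_upwards [hf.lipschitz] with h hl x hx y hy
  rw [dist_eq_norm]
  exact hl x hx y hy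

end SmoothSetting

/-! ### The choice of smoothing radius, noise level, step parameters and number of steps -/

section Parameters

variable {n : ℕ} {ε δ M₂ L₂ : ℝ}

theorem smoothingRadius_pos (hn : 0 < n) (hε : 0 < ε) (hM : 0 < M₂) (hL : 0 < L₂) :
    0 < smoothingRadius n ε M₂ L₂ := by
  have : (0 : ℝ) < n := by exact_mod_cast hn
  exact lt_min (lt_max_of_lt_left (by positivity)) (by positivity)

/-- The alternatives of the maximum match those of the minimum: μ ≤ ε/(2M₂) bounds the Lipschitz
term, μ ≤ √(ε/L₂) the quadratic one. -/
theorem bias_le (hε : 0 < ε) (hM : 0 < M₂) (hL : 0 < L₂) (hμ : 0 < smoothingRadius n ε M₂ L₂) :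
    min (M₂ * smoothingRadius n ε M₂ L₂) (L₂ / 2 * smoothingRadius n ε M₂ L₂ ^ 2) ≤ ε / 2 := by
  have h := min_le_left (max (ε / (2 * M₂)) (Real.sqrt (ε / L₂)))
    (M₂ / L₂ * Real.sqrt (1 / (6 * n)))
  change smoothingRadius n ε M₂ L₂ ≤ _ at h
  rcases le_max_iff.1 h with h | h
  · refine (min_le_left _ _).trans ?_
    rw [le_div_iff₀ (by positivity)] at h
    linarith
  · refine (min_le_right _ _).trans ?_
    have h2 := pow_le_pow_left₀ hμ.le h 2
    rw [Real.sq_sqrt (by positivity), le_div_iff₀ hL] at h2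
    linarith

/-- The bounds on μ and δ contribute M₂²/24 each, so the bracket is at most (7/5 + 7/12)M₂² ≤ 2M₂²;
the factor (5/2) ln n then gives the constant 5. -/
theorem second_moment_const_le {n : ℕ} (hn : 2 ≤ n) (hM : 0 < M₂) (hL : 0 < L₂) (hδ0 : 0 ≤ δ)
    {μ : ℝ} (hμ : 0 < μ) (hμn : μ ≤ M₂ / L₂ * Real.sqrt (1 / (6 * n)))
    (hδ : δ ≤ M₂ * μ / Real.sqrt (96 * n)) :
    n * supMoment n * (7 / 5 * M₂ ^ 2 + 7 * n * (L₂ ^ 2 * μ ^ 2 / 4 + 4 * δ ^ 2 / μ ^ 2)) ≤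
      5 * M₂ ^ 2 * Real.log n := by
  have hn0 : (0 : ℝ) < n := by exact_mod_cast (by omega : 0 < n)
  have h1 : L₂ ^ 2 * μ ^ 2 ≤ M₂ ^ 2 / (6 * n) := by
    have h2 := pow_le_pow_left₀ hμ.le hμn 2
    rw [mul_pow, Real.sq_sqrt (by positivity), div_pow] at h2
    calc _ ≤ L₂ ^ 2 * (M₂ ^ 2 / L₂ ^ 2 * (1 / (6 * n))) := by gcongr
      _ = _ := by field_simp
  have h2 : δ ^ 2 / μ ^ 2 ≤ M₂ ^ 2 / (96 * n) := by
    have h3 := pow_le_pow_left₀ hδ0 hδ 2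
    rw [div_pow, Real.sq_sqrt (by positivity)] at h3
    rw [div_le_iff₀ (by positivity)]
    calc _ ≤ _ := h3
      _ = _ := by ring
  have h3 : 7 / 5 * M₂ ^ 2 + 7 * n * (L₂ ^ 2 * μ ^ 2 / 4 + 4 * δ ^ 2 / μ ^ 2) ≤ 2 * M₂ ^ 2 := by
    have h4 : n * (L₂ ^ 2 * μ ^ 2 / 4 + 4 * δ ^ 2 / μ ^ 2) ≤
        n * (M₂ ^ 2 / (6 * n) / 4 + 4 * (M₂ ^ 2 / (96 * n))) := by
      rw [mul_div_assoc 4]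
      gcongr
    have h5 : n * (M₂ ^ 2 / (6 * n) / 4 + 4 * (M₂ ^ 2 / (96 * n))) = M₂ ^ 2 / 12 := by
      field_simp; ring
    nlinarith [sq_nonneg M₂]
  have : NeZero n := ⟨by omega⟩
  have h4 := mul_supMoment_le hn
  have h5 := supMoment_nonneg (n := n)
  calc _ ≤ n * supMoment n * (2 * M₂ ^ 2) := by gcongr
    _ ≤ 5 / 2 * Real.log n * (2 * M₂ ^ 2) := by gcongr
    _ = _ := by ring

theorem sum_inv_sqrt_le (N : ℕ) :
    ∑ t ∈ Finset.range N, 1 / Real.sqrt (t + 1 : ℕ) ≤ 2 * Real.sqrt N := by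
  induction N with
  | zero => simp
  | succ N ih =>
    rw [Finset.sum_range_succ]
    have h1 : 0 < Real.sqrt ((N + 1 : ℕ) : ℝ) := Real.sqrt_pos.2 (by positivity)
    have h2 : Real.sqrt ((N + 1 : ℕ) : ℝ) ^ 2 = N + 1 := by
      rw [Real.sq_sqrt (by positivity)]; push_cast; ring
    have h3 : Real.sqrt (N : ℝ) ^ 2 = N := Real.sq_sqrt (by positivity)
    have h4 : 1 / Real.sqrt ((N + 1 : ℕ) : ℝ) ≤
        2 * Real.sqrt ((N + 1 : ℕ) : ℝ) - 2 * Real.sqrt N := by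
      rw [div_le_iff₀ h1]
      nlinarith [sq_nonneg (Real.sqrt ((N + 1 : ℕ) : ℝ) - Real.sqrt N)]
    linarith

theorem stepParam_pos (hM : 0 < M₂) (t : ℕ) : 0 < stepParam M₂ (t + 1) :=
  mul_pos hM (Real.sqrt_pos.2 (by positivity))

theorem stepParam_mono (hM : 0 < M₂) : Monotone fun t => stepParam M₂ (t + 1) := by
  intro s t hst
  simp only [stepParam]
  gcongr

theorem iterationCount_pos {n : ℕ} (hn : 2 ≤ n) (hε : 0 < ε) (hM : 0 < M₂) :
    0 < iterationCount n ε M₂ := by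
  have hlog : 0 < Real.log n := Real.log_pos (by exact_mod_cast (by omega : 1 < n))
  exact Nat.ceil_pos.2 (by positivity)

/-- For this step parameter both terms are at most √5 M₂ ln n times the root of the number of steps.
The constant 80 = (4√5)² is what brings their sum down to half of ε per step. -/
theorem rate_le {n : ℕ} (hn : 2 ≤ n) (hε : 0 < ε) (hM : 0 < M₂) {N : ℕ}
    (hN : iterationCount n ε M₂ = N + 1) :
    stepParam M₂ (N + 1) * Real.log n +
      ∑ t ∈ Finset.range (N + 1), 5 * M₂ ^ 2 * Real.log n / (2 * stepParam M₂ (t + 1)) ≤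
        (N + 1 : ℕ) * (ε / 2) := by
  have hlog : 0 < Real.log n := Real.log_pos (by exact_mod_cast (by omega : 1 < n))
  have h5 : 0 < Real.sqrt 5 := by positivity
  have h55 : Real.sqrt 5 ^ 2 = 5 := Real.sq_sqrt (by norm_num)
  have hs : ∀ t : ℕ, stepParam M₂ t = M₂ * Real.sqrt 5 * Real.sqrt t := fun t => by
    rw [stepParam, Real.sqrt_mul (by norm_num), mul_assoc]
  set r := Real.sqrt ((N + 1 : ℕ) : ℝ)
  have hr : 0 < r := Real.sqrt_pos.2 (by positivity)
  have hr2 : r ^ 2 = (N + 1 : ℕ) := Real.sq_sqrt (by positivity)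
  have h1 : ∑ t ∈ Finset.range (N + 1), 5 * M₂ ^ 2 * Real.log n / (2 * stepParam M₂ (t + 1)) ≤
      M₂ * Real.sqrt 5 * Real.log n * r := by
    have : ∀ t : ℕ, 5 * M₂ ^ 2 * Real.log n / (2 * stepParam M₂ (t + 1)) =
        M₂ * Real.sqrt 5 * Real.log n / 2 * (1 / Real.sqrt ((t + 1 : ℕ) : ℝ)) := fun t => by
      have ht : 0 < Real.sqrt ((t + 1 : ℕ) : ℝ) := Real.sqrt_pos.2 (by positivity)
      rw [hs]
      field_simp
      rw [h55]
    simp_rw [this]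
    rw [← Finset.mul_sum]
    calc _ ≤ M₂ * Real.sqrt 5 * Real.log n / 2 * (2 * r) := by
          gcongr; exact sum_inv_sqrt_le (N + 1)
      _ = _ := by ring
  have h2 : 80 * M₂ ^ 2 * Real.log n ^ 2 / ε ^ 2 ≤ r ^ 2 := by
    rw [hr2, ← hN]; exact Nat.le_ceil _
  have h3 : 4 * Real.sqrt 5 * M₂ * Real.log n ≤ r * ε := by
    refine (pow_le_pow_iff_left₀ (by positivity) (by positivity) two_ne_zero).1 ?_
    rw [div_le_iff₀ (by positivity)] at h2
    calc _ = 16 * Real.sqrt 5 ^ 2 * M₂ ^ 2 * Real.log n ^ 2 := by ring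
      _ = 80 * M₂ ^ 2 * Real.log n ^ 2 := by rw [h55]; ring
      _ ≤ _ := h2
      _ = _ := by ring
  rw [hs]
  calc _ ≤ M₂ * Real.sqrt 5 * r * Real.log n + M₂ * Real.sqrt 5 * Real.log n * r := by
        gcongr
    _ = (4 * Real.sqrt 5 * M₂ * Real.log n) * r / 2 := by ring
    _ ≤ (r * ε) * r / 2 := by gcongr
    _ = r ^ 2 * (ε / 2) := by ring
    _ = _ := by rw [hr2]

end Parameters

/-! ### Expectations over a single step -/

theorem integral_of_indepFun {Ω α β : Type*} [MeasurableSpace Ω] [MeasurableSpace α]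
    [MeasurableSpace β] {P : Measure Ω} [IsProbabilityMeasure P] {A : Ω → α} {B : Ω → β}
    (hA : Measurable A) (hB : Measurable B) (hind : IndepFun A B P) {G : α → β → ℝ}
    (hG : Measurable (Function.uncurry G)) (hint : Integrable (fun ω => G (A ω) (B ω)) P) :
    Integrable (fun ω => ∫ a, G a (B ω) ∂(P.map A)) P ∧
      ∫ ω, G (A ω) (B ω) ∂P = ∫ ω, ∫ a, G a (B ω) ∂(P.map A) ∂P := by
  have := Measure.isProbabilityMeasure_map (μ := P) hA.aemeasurable
  have := Measure.isProbabilityMeasure_map (μ := P) hB.aemeasurable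
  have hmap := (indepFun_iff_map_prod_eq_prod_map_map hA.aemeasurable hB.aemeasurable).1 hind
  have h1 : Integrable (Function.uncurry G) ((P.map A).prod (P.map B)) := by
    rw [← hmap, integrable_map_measure hG.aestronglyMeasurable (hA.prodMk hB).aemeasurable]
    exact hint
  refine ⟨?_, ?_⟩
  · have h2 := h1.integral_prod_right
    exact (integrable_map_measure h2.aestronglyMeasurable hB.aemeasurable).1 h2
  · have h3 : ∫ ω, G (A ω) (B ω) ∂P = ∫ p, Function.uncurry G p ∂((P.map A).prod (P.map B)) := by
      rw [← hmap, integral_map (hA.prodMk hB).aemeasurable hG.aestronglyMeasurable]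
      rfl
    rw [h3, integral_prod_symm _ h1,
      integral_map hB.aemeasurable h1.integral_prod_right.aestronglyMeasurable]
    rfl

section Simplex

variable {n : ℕ} [NeZero n]

theorem norm_le_one_of_mem_simplex {x : Vec n} (hx : x ∈ simplex n) : ‖x‖ ≤ 1 := by
  have h1 : ∀ i, x i ≤ 1 := fun i => by
    rw [← hx.2]; exact Finset.single_le_sum (fun j _ => hx.1 j) (Finset.mem_univ i)
  have h2 : ‖x‖ ^ 2 ≤ 1 := by
    rw [EuclideanSpace.real_norm_sq_eq, ← hx.2]
    exact Finset.sum_le_sum fun i _ => by nlinarith [h1 i, hx.1 i]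
  nlinarith [norm_nonneg x]

theorem norm_sub_le_two {x y : Vec n} (hx : x ∈ simplex n) (hy : y ∈ simplex n) :
    ‖x - y‖ ≤ 2 := by
  linarith [norm_sub_le x y, norm_le_one_of_mem_simplex hx, norm_le_one_of_mem_simplex hy]

theorem abs_inner_sub_le {x y e : Vec n} (hx : x ∈ simplex n) (hy : y ∈ simplex n)
    (he : ‖e‖ = 1) : |inner ℝ e (x - y)| ≤ 2 := by
  refine (abs_real_inner_le_norm _ _).trans ?_
  rw [he, one_mul]; exact norm_sub_le_two hx hy

theorem measurable_mirror (β : ℝ) : Measurable (mirror β : Vec n → Vec n) := by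
  have : Continuous (mirror β : Vec n → Vec n) := by
    refine (PiLp.continuous_toLp 2 _).comp (continuous_pi fun i => ?_)
    exact Continuous.div (by fun_prop) (by fun_prop) fun s => (sum_exp_pos β s).ne'
  exact this.measurable

end Simplex

section Step

variable {n : ℕ} [NeZero n] {H Ω Z : Type*} [MeasurableSpace H] [MeasurableSpace Ω]
  [MeasurableSpace Z] {ν : Measure H} [IsProbabilityMeasure ν] {P : Measure Ω}
  [IsProbabilityMeasure P] {φ : Vec n → H → ℝ} {K L : H → ℝ} {μ₀ μ δ : ℝ}
  {e : Ω → Vec n} {η : Ω → H} {ξ : Ω → ℝ} {z : Ω → Z} {x : Z → Vec n} {u : Vec n}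

theorem ae_norm_direction (he : Measurable e) (hlaw : P.map e = uniformSphere n) :
    ∀ᵐ ω ∂P, ‖e ω‖ = 1 :=
  ae_of_ae_map he.aemeasurable (hlaw ▸ ae_norm_eq_one)

/-- With past and noise frozen, the direction is still uniform and hence centred. -/
theorem noise_term (he : Measurable e) (hlaw : P.map e = uniformSphere n) (hz : Measurable z)
    (hξ : Measurable ξ) (hind : IndepFun e (fun ω => (z ω, ξ ω)) P) (hξδ : ∀ᵐ ω ∂P, |ξ ω| ≤ δ)
    (hx : Measurable x) (hxs : ∀ p, x p ∈ simplex n) (hu : u ∈ simplex n) :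
    Integrable (fun ω => ξ ω * inner ℝ (e ω) (x (z ω) - u)) P ∧
      ∫ ω, ξ ω * inner ℝ (e ω) (x (z ω) - u) ∂P = 0 := by
  have hi : Integrable (fun ω => ξ ω * inner ℝ (e ω) (x (z ω) - u)) P := by
    refine Integrable.of_bound
      (hξ.mul (he.inner ((hx.comp hz).sub_const u))).aestronglyMeasurable (δ * 2) ?_
    filter_upwards [hξδ, ae_norm_direction he hlaw] with ω h1 h2
    rw [Real.norm_eq_abs, abs_mul]
    exact mul_le_mul h1 (abs_inner_sub_le (hxs _) hu h2) (abs_nonneg _) ((abs_nonneg _).trans h1)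
  refine ⟨hi, ?_⟩
  have h := (integral_of_indepFun he (hz.prodMk hξ) hind
    (G := fun a b => b.2 * inner ℝ a (x b.1 - u)) ?_ hi).2
  · rw [h, hlaw]
    simp [integral_const_mul, integral_uniformSphere_inner]
  · exact (measurable_snd.comp measurable_snd).mul
      (measurable_fst.inner ((hx.comp (measurable_fst.comp measurable_snd)).sub_const u))

theorem measurable_increment (hφ : Measurable (Function.uncurry φ)) {α : Type*} [MeasurableSpace α]
    {y d : α → Vec n} {h : α → H} (hy : Measurable y) (hd : Measurable d) (hh : Measurable h) :
    Measurable fun a => φ (y a + μ • d a) (h a) - φ (y a) (h a) :=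
  (hφ.comp ((hy.add (hd.const_smul μ)).prodMk hh)).sub (hφ.comp (hy.prodMk hh))

theorem SmoothConvex.abs_increment_le {ψ : Vec n → ℝ} {k l : ℝ} (h : SmoothConvex μ₀ ψ k l)
    (hμ : 0 < μ) (hμμ₀ : μ ≤ μ₀) {y d : Vec n} (hy : y ∈ simplex n) (hd : ‖d‖ = 1) :
    |ψ (y + μ • d) - ψ y| ≤ k * μ := by
  have := h.lipschitz _ (smul_mem_closedNhd hμ hμμ₀ hy hd.le) y (simplex_subset_closedNhd hy)
  rwa [add_sub_cancel_left, norm_smul, hd, mul_one, Real.norm_of_nonneg hμ.le] at this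

/-- The base value is kept on the left because only the increment has an integrable bound of the
form K(η)μ; after exchanging the integrals it drops out, the direction being centred. -/
theorem integral_integral_increment (hf : SmoothSetting ν μ₀ φ K L)
    (hφ : Measurable (Function.uncurry φ)) (hμ : 0 < μ) (hμμ₀ : μ ≤ μ₀) {y : Vec n}
    (hy : y ∈ simplex n) (hu : u ∈ simplex n) :
    ∫ h, ∫ d, (φ (y + μ • d) h - φ y h) * inner ℝ d (y - u) ∂uniformSphere n ∂ν =
      ∫ d, objective ν φ (y + μ • d) * inner ℝ d (y - u) ∂uniformSphere n := by
  have hm : Measurable fun p : H × Vec n =>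
      (φ (y + μ • p.2) p.1 - φ y p.1) * inner ℝ p.2 (y - u) :=
    (measurable_increment hφ measurable_const measurable_snd measurable_fst).mul
      (measurable_snd.inner measurable_const)
  have hKi := hf.lipschitz_memLp.integrable one_le_two
  have hi : Integrable (fun p : H × Vec n =>
      (φ (y + μ • p.2) p.1 - φ y p.1) * inner ℝ p.2 (y - u)) (ν.prod (uniformSphere n)) := by
    refine (((hKi.mul_const μ).mul_const 2).comp_fst (uniformSphere n)).mono'
      hm.aestronglyMeasurable ?_
    filter_upwards [Measure.quasiMeasurePreserving_fst.ae hf.smoothConvex,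
      Measure.quasiMeasurePreserving_snd.ae (ae_norm_eq_one (n := n))] with p h1 h2
    rw [Real.norm_eq_abs, abs_mul]
    have h3 := h1.abs_increment_le hμ hμμ₀ hy h2
    exact mul_le_mul h3 (abs_inner_sub_le hy hu h2) (abs_nonneg _) ((abs_nonneg _).trans h3)
  rw [integral_integral_swap hi]
  have h1 : (fun d => ∫ h, (φ (y + μ • d) h - φ y h) * inner ℝ d (y - u) ∂ν) =ᵐ[uniformSphere n]
      fun d => objective ν φ (y + μ • d) * inner ℝ d (y - u) -
        objective ν φ y * inner ℝ d (y - u) := by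
    filter_upwards [ae_norm_eq_one] with d hd
    rw [integral_mul_const, integral_sub
      (hf.integrable _ (SmoothConvex.smul_mem_closedNhd hμ hμμ₀ hy hd.le))
      (hf.integrable _ (simplex_subset_closedNhd hy)), sub_mul]
    rfl
  have h2 : Integrable (fun d : Vec n => objective ν φ y * inner ℝ d (y - u)) (uniformSphere n) :=
    integrable_uniformSphere (by fun_prop)
  have h3 : Integrable (fun d => objective ν φ (y + μ • d) * inner ℝ d (y - u))
      (uniformSphere n) := by
    have h4 := hi.integral_prod_right
    exact ((h4.congr h1).add h2).congr (ae_of_all _ fun d => sub_add_cancel _ _)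
  rw [integral_congr_ae h1, integral_sub h3 h2, integral_const_mul, integral_uniformSphere_inner,
    mul_zero, sub_zero]

theorem integrable_objective_comp (hf : SmoothSetting ν μ₀ φ K L) {X : Ω → Vec n}
    (hX : Measurable X) (hXs : ∀ ω, X ω ∈ simplex n) :
    Integrable (fun ω => objective ν φ (X ω)) P := by
  have h := hf.objective_smoothConvex
  have hlip : LipschitzOnWith (Real.toNNReal (rms ν K)) (objective ν φ) (closedNhd n μ₀) := by
    refine LipschitzOnWith.of_dist_le_mul fun p hp q hq => ?_
    rw [Real.dist_eq, dist_eq_norm]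
    exact (h.lipschitz p hp q hq).trans (by gcongr; exact Real.le_coe_toNNReal _)
  obtain ⟨G, hG, hGe⟩ := hlip.extend_real
  have heq : (fun ω => objective ν φ (X ω)) = fun ω => G (X ω) := by
    ext ω; exact hGe (simplex_subset_closedNhd (hXs ω))
  obtain ⟨C, hC⟩ := isCompact_simplex.exists_bound_of_continuousOn
    (h.continuousOn.mono (simplex_subset_closedNhd (n := n) (μ₀ := μ₀)))
  refine Integrable.of_bound ?_ C (ae_of_all _ fun ω => hC _ (hXs ω))
  rw [heq]
  exact (hG.continuous.measurable.comp hX).aestronglyMeasurable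

theorem memLp_comp_realisation (hη : Measurable η) (hlaw : P.map η = ν) {k : H → ℝ}
    (hk : MemLp k 2 ν) : MemLp (fun ω => k (η ω)) 2 P :=
  hk.comp_measurePreserving ⟨hη, hlaw⟩

/-- The direction is averaged with past and realisation frozen, then the realisation with the past
frozen. What remains is the objective itself, to which the first-moment bound applies pointwise. -/
theorem value_term (hf : SmoothSetting ν μ₀ φ K L) (hφ : Measurable (Function.uncurry φ))
    (hμ : 0 < μ) (hμμ₀ : μ ≤ μ₀) (he : Measurable e) (hη : Measurable η) (hz : Measurable z)
    (hlaw : P.map e = uniformSphere n) (hlawη : P.map η = ν)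
    (hind : IndepFun e (fun ω => (z ω, η ω)) P) (hindη : IndepFun η z P)
    (hx : Measurable x) (hxs : ∀ p, x p ∈ simplex n) (hu : u ∈ simplex n) :
    Integrable (fun ω => (φ (x (z ω) + μ • e ω) (η ω) - φ (x (z ω)) (η ω)) *
        inner ℝ (e ω) (x (z ω) - u)) P ∧
      (∫ ω, objective ν φ (x (z ω)) ∂P) - objective ν φ u -
          min (rms ν K * μ) (rms ν L / 2 * μ ^ 2) ≤
        n / μ * ∫ ω, (φ (x (z ω) + μ • e ω) (η ω) - φ (x (z ω)) (η ω)) *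
          inner ℝ (e ω) (x (z ω) - u) ∂P := by
  have hn : (0 : ℝ) < n := Nat.cast_pos.2 (NeZero.pos n)
  have hxz := hx.comp hz
  have hK2 := memLp_comp_realisation hη hlawη hf.lipschitz_memLp
  have hi : Integrable (fun ω => (φ (x (z ω) + μ • e ω) (η ω) - φ (x (z ω)) (η ω)) *
      inner ℝ (e ω) (x (z ω) - u)) P := by
    refine (((hK2.integrable one_le_two).mul_const μ).mul_const 2).mono'
      ((measurable_increment hφ hxz he hη).mul
        (he.inner (hxz.sub_const u))).aestronglyMeasurable ?_
    filter_upwards [ae_of_ae_map hη.aemeasurable (hlawη ▸ hf.smoothConvex),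
      ae_norm_direction he hlaw] with ω h1 h2
    rw [Real.norm_eq_abs, abs_mul]
    have h3 := h1.abs_increment_le hμ hμμ₀ (hxs (z ω)) h2
    exact mul_le_mul h3 (abs_inner_sub_le (hxs _) hu h2) (abs_nonneg _) ((abs_nonneg _).trans h3)
  refine ⟨hi, ?_⟩
  let G : Vec n → Z × H → ℝ := fun d b =>
    (φ (x b.1 + μ • d) b.2 - φ (x b.1) b.2) * inner ℝ d (x b.1 - u)
  have hG : Measurable (Function.uncurry G) :=
    (measurable_increment hφ (hx.comp (measurable_fst.comp measurable_snd)) measurable_fst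
      (measurable_snd.comp measurable_snd)).mul
      (measurable_fst.inner ((hx.comp (measurable_fst.comp measurable_snd)).sub_const u))
  obtain ⟨hi1, he1⟩ := integral_of_indepFun he (hz.prodMk hη) hind hG hi
  rw [hlaw] at hi1 he1
  have hG2 : Measurable (Function.uncurry fun (h : H) (p : Z) =>
      ∫ d, G d (p, h) ∂uniformSphere n) := by
    have : StronglyMeasurable fun q : H × Z => ∫ d, G d (q.2, q.1) ∂uniformSphere n := by
      refine StronglyMeasurable.integral_prod_right (f := fun (q : H × Z) d => G d (q.2, q.1)) ?_
      exact (hG.comp (measurable_snd.prodMk ((measurable_snd.comp measurable_fst).prodMk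
        (measurable_fst.comp measurable_fst)))).stronglyMeasurable
    exact this.measurable
  obtain ⟨hi2, he2⟩ := integral_of_indepFun hη hz hindη hG2 hi1
  rw [hlawη] at hi2 he2
  have hval : ∀ ω, ∫ h, ∫ d, G d (z ω, h) ∂uniformSphere n ∂ν =
      ∫ d, objective ν φ (x (z ω) + μ • d) * inner ℝ d (x (z ω) - u) ∂uniformSphere n :=
    fun ω => integral_integral_increment hf hφ hμ hμμ₀ (hxs _) hu
  have hK0 : 0 ≤ rms ν K := Real.sqrt_nonneg _
  have hL0 : 0 ≤ rms ν L := Real.sqrt_nonneg _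
  have hF : Integrable (fun ω => objective ν φ (x (z ω))) P :=
    integrable_objective_comp hf hxz fun ω => hxs (z ω)
  change _ ≤ n / μ * ∫ ω, G (e ω) (z ω, η ω) ∂P
  rw [he1, he2, ← integral_const_mul]
  have h0 : ∫ ω, objective ν φ (x (z ω)) ∂P - objective ν φ u -
      min (rms ν K * μ) (rms ν L / 2 * μ ^ 2) = ∫ ω, (objective ν φ (x (z ω)) -
        (objective ν φ u + min (rms ν K * μ) (rms ν L / 2 * μ ^ 2))) ∂P := by
    rw [integral_sub hF (integrable_const _)]
    simp [sub_sub]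
  rw [h0]
  refine integral_mono (hF.sub (integrable_const _)) (hi2.const_mul _) fun ω => ?_
  simp only [hval]
  have := hf.objective_smoothConvex.first_moment_ge hK0 hL0 hμ hμμ₀ (hxs (z ω)) hu
  linarith

/-- The deterministic bound is used for each realisation with its own K(η) and L(η). They occur only
squared, so their expectations are exactly the squared root mean squares. -/
theorem second_moment_term (hf : SmoothSetting ν μ₀ φ K L) (hφ : Measurable (Function.uncurry φ))
    (hδ : 0 ≤ δ) (hμ : 0 < μ) (hμμ₀ : μ ≤ μ₀) (he : Measurable e) (hη : Measurable η)
    (hz : Measurable z) (hlaw : P.map e = uniformSphere n) (hlawη : P.map η = ν)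
    (hind : IndepFun e (fun ω => (z ω, η ω)) P)
    (hx : Measurable x) (hxs : ∀ p, x p ∈ simplex n) :
    Integrable (fun ω => (n / μ * supNorm (e ω) *
        (|φ (x (z ω) + μ • e ω) (η ω) - φ (x (z ω)) (η ω)| + 2 * δ)) ^ 2) P ∧
      ∫ ω, (n / μ * supNorm (e ω) *
        (|φ (x (z ω) + μ • e ω) (η ω) - φ (x (z ω)) (η ω)| + 2 * δ)) ^ 2 ∂P ≤
      n * supMoment n * (7 / 5 * rms ν K ^ 2 +
        7 * n * (rms ν L ^ 2 * μ ^ 2 / 4 + 4 * δ ^ 2 / μ ^ 2)) := by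
  have hn : (0 : ℝ) < n := Nat.cast_pos.2 (NeZero.pos n)
  have hxz := hx.comp hz
  have hK2 := memLp_comp_realisation hη hlawη hf.lipschitz_memLp
  have hL2 := memLp_comp_realisation hη hlawη hf.gradient_lipschitz_memLp
  have hgood := ae_of_ae_map hη.aemeasurable (hlawη ▸ hf.smoothConvex)
  let G : Vec n → Z × H → ℝ := fun d b => (n / μ * supNorm d *
    (|φ (x b.1 + μ • d) b.2 - φ (x b.1) b.2| + 2 * δ)) ^ 2
  have hs : Measurable (supNorm : Vec n → ℝ) := continuous_supNorm.measurable
  have habs : Measurable fun r : ℝ => |r| := continuous_abs.measurable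
  have hG : Measurable (Function.uncurry G) :=
    (((hs.comp measurable_fst).const_mul _).mul ((habs.comp (measurable_increment hφ
      (hx.comp (measurable_fst.comp measurable_snd)) measurable_fst
      (measurable_snd.comp measurable_snd))).add_const _)).pow_const 2
  have hi : Integrable (fun ω => G (e ω) (z ω, η ω)) P := by
    have hb : MemLp (fun ω => n / μ * (K (η ω) * μ + 2 * δ)) 2 P :=
      ((hK2.mul_const μ).add (memLp_const _)).const_mul _
    refine hb.integrable_sq.mono'
      (hG.comp (he.prodMk (hz.prodMk hη))).aestronglyMeasurable ?_
    filter_upwards [hgood, ae_norm_direction he hlaw] with ω h1 h2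
    have h3 := h1.abs_increment_le hμ hμμ₀ (hxs (z ω)) h2
    rw [Real.norm_of_nonneg (sq_nonneg _)]
    have h4 := supNorm_nonneg (e ω)
    have h5 : supNorm (e ω) ≤ 1 := h2 ▸ supNorm_le_norm (e ω)
    have h6 : n / μ * supNorm (e ω) *
        (|φ (x (z ω) + μ • e ω) (η ω) - φ (x (z ω)) (η ω)| + 2 * δ) ≤
          n / μ * 1 * (K (η ω) * μ + 2 * δ) := by gcongr
    rw [mul_one] at h6
    gcongr
  refine ⟨hi, ?_⟩
  obtain ⟨hi1, he1⟩ := integral_of_indepFun he (hz.prodMk hη) hind hG hi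
  rw [hlaw] at hi1 he1
  change ∫ ω, G (e ω) (z ω, η ω) ∂P ≤ _
  rw [he1]
  have hiq1 : Integrable (fun ω => 7 / 5 * K (η ω) ^ 2) P := hK2.integrable_sq.const_mul _
  have hiq2 : Integrable (fun ω => L (η ω) ^ 2 * μ ^ 2 / 4) P :=
    (hL2.integrable_sq.mul_const _).div_const _
  have hiq3 : Integrable (fun ω => 7 * n * (L (η ω) ^ 2 * μ ^ 2 / 4 + 4 * δ ^ 2 / μ ^ 2)) P :=
    (hiq2.add (integrable_const _)).const_mul _
  have hK0 := ae_of_ae_map hη.aemeasurable (hlawη ▸ hf.K_nonneg (hμ.trans_le hμμ₀))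
  have hle : ∫ ω, ∫ d, G d (z ω, η ω) ∂uniformSphere n ∂P ≤
      ∫ ω, n * supMoment n * (7 / 5 * K (η ω) ^ 2 +
        7 * n * (L (η ω) ^ 2 * μ ^ 2 / 4 + 4 * δ ^ 2 / μ ^ 2)) ∂P := by
    refine integral_mono_ae hi1 ((hiq1.add hiq3).const_mul _) ?_
    filter_upwards [hgood, hK0] with ω h1 h2
    have := h1.second_moment_le h2 hδ hμ hμμ₀ (hxs (z ω))
    simpa only [G, mul_pow] using this
  refine hle.trans_eq ?_
  have hcomp : ∀ k : H → ℝ, MemLp k 2 ν → ∫ ω, k (η ω) ^ 2 ∂P = rms ν k ^ 2 := fun k hk => by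
    rw [sq_rms, ← hlawη, integral_map hη.aemeasurable]
    rw [hlawη]
    exact hk.aestronglyMeasurable.pow 2
  rw [integral_const_mul, integral_add hiq1 hiq3, integral_const_mul, integral_const_mul,
    integral_add hiq2 (integrable_const _), integral_div, integral_mul_const,
    hcomp K hf.lipschitz_memLp, hcomp L hf.gradient_lipschitz_memLp]
  simp

end Step

/-! ### The whole run -/

section Run

variable {n : ℕ} [NeZero n] {H Ω : Type*} [MeasurableSpace H] [MeasurableSpace Ω]
  {ν : Measure H} [IsProbabilityMeasure ν] {P : Measure Ω} [IsProbabilityMeasure P]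
  {φ : Vec n → H → ℝ} {K L : H → ℝ} {μ₀ μ δ M₂ ε : ℝ}
  {e : ℕ → Ω → Vec n} {η : ℕ → Ω → H} {ξ ξ₀ : ℕ → Ω → ℝ} {u : Vec n}

theorem measurable_history (ho : OracleModel P ν δ e η ξ ξ₀) (t : ℕ) :
    Measurable (history e η ξ ξ₀ t) :=
  measurable_pi_lambda _ fun j => (ho.measurable_direction j).prodMk
    ((ho.measurable_realisation j).prodMk ((ho.measurable_noise j).prodMk (ho.measurable_noise₀ j)))

/-- The sum of the estimates is a measurable function of the history. -/
theorem exists_estimateSum_eq (hφ : Measurable (Function.uncurry φ)) (μ M₂ : ℝ)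
    (e : ℕ → Ω → Vec n) (η : ℕ → Ω → H) (ξ ξ₀ : ℕ → Ω → ℝ) (t : ℕ) :
    ∃ Φ : (Fin t → Vec n × H × ℝ × ℝ) → Vec n, Measurable Φ ∧
      ∀ ω, estimateSum φ μ M₂ e η ξ ξ₀ ω t = Φ (history e η ξ ξ₀ t ω) := by
  induction t with
  | zero => exact ⟨fun _ => 0, measurable_const, fun _ => rfl⟩
  | succ t ih =>
    obtain ⟨Φ, hΦ, h⟩ := ih
    have hinit : Measurable fun (p : Fin (t + 1) → Vec n × H × ℝ × ℝ) (j : Fin t) =>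
        p j.castSucc := measurable_pi_lambda _ fun j => measurable_pi_apply _
    have hlast : Measurable fun p : Fin (t + 1) → Vec n × H × ℝ × ℝ => p (Fin.last t) :=
      measurable_pi_apply _
    refine ⟨fun p => Φ (fun j => p j.castSucc) + gradEstimate φ μ
      (mirror (stepParam M₂ (t + 1)) (Φ fun j => p j.castSucc))
      (p (Fin.last t)).1 (p (Fin.last t)).2.1 (p (Fin.last t)).2.2.1 (p (Fin.last t)).2.2.2,
      ?_, fun ω => ?_⟩
    · have hS := hΦ.comp hinit
      have hX := (measurable_mirror (n := n) (stepParam M₂ (t + 1))).comp hS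
      have he := hlast.fst
      have hη := hlast.snd.fst
      have hξ := hlast.snd.snd.fst
      have hξ₀ := hlast.snd.snd.snd
      refine hS.add ((Measurable.const_mul (((hφ.comp ((hX.add (he.const_smul μ)).prodMk hη)).add
        hξ).sub ((hφ.comp (hX.prodMk hη)).add hξ₀)) _).smul he)
    · rw [estimateSum, h]
      rfl

theorem iterate_mem_simplex (f : Vec n → H → ℝ) (t : ℕ) (ω : Ω) :
    iterate f μ M₂ e η ξ ξ₀ t ω ∈ simplex n := mirror_mem_simplex _ _

theorem average_mem_simplex (f : Vec n → H → ℝ) {N : ℕ} (hN : 0 < N) (ω : Ω) :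
    average f μ M₂ e η ξ ξ₀ N ω ∈ simplex n := by
  have hN' : (N : ℝ) ≠ 0 := Nat.cast_ne_zero.2 hN.ne'
  rw [average, Finset.smul_sum]
  exact convex_simplex.sum_mem (fun _ _ => by positivity) (by simp [hN'])
    fun t _ => iterate_mem_simplex f t ω

theorem objective_average_le (hf : SmoothSetting ν μ₀ φ K L) {N : ℕ} (hN : 0 < N) (ω : Ω) :
    objective ν φ (average φ μ M₂ e η ξ ξ₀ N ω) ≤
      1 / N * ∑ t ∈ Finset.range N, objective ν φ (iterate φ μ M₂ e η ξ ξ₀ t ω) := by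
  have hN' : (N : ℝ) ≠ 0 := Nat.cast_ne_zero.2 hN.ne'
  rw [average, Finset.smul_sum, Finset.mul_sum]
  exact hf.objective_smoothConvex.convex.map_sum_le (fun _ _ => by positivity) (by simp [hN'])
    fun t _ => simplex_subset_closedNhd (iterate_mem_simplex φ t ω)

theorem delta_nonneg (ho : OracleModel P ν δ e η ξ ξ₀) : 0 ≤ δ := by
  obtain ⟨ω, h⟩ := (ho.noise_le 0).exists
  exact (abs_nonneg _).trans h

/-- The increment of the function in step `t`. -/
def increment (φ : Vec n → H → ℝ) (μ M₂ : ℝ) (e : ℕ → Ω → Vec n) (η : ℕ → Ω → H)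
    (ξ ξ₀ : ℕ → Ω → ℝ) (t : ℕ) (ω : Ω) : ℝ :=
  φ (iterate φ μ M₂ e η ξ ξ₀ t ω + μ • e t ω) (η t ω) - φ (iterate φ μ M₂ e η ξ ξ₀ t ω) (η t ω)

/-- The gradient estimate of step `t` along the run. -/
def runEstimate (φ : Vec n → H → ℝ) (μ M₂ : ℝ) (e : ℕ → Ω → Vec n) (η : ℕ → Ω → H)
    (ξ ξ₀ : ℕ → Ω → ℝ) (t : ℕ) (ω : Ω) : Vec n :=
  gradEstimate φ μ (iterate φ μ M₂ e η ξ ξ₀ t ω) (e t ω) (η t ω) (ξ t ω) (ξ₀ t ω)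

theorem runEstimate_eq (t : ℕ) (ω : Ω) : runEstimate φ μ M₂ e η ξ ξ₀ t ω =
    (n / μ * (increment φ μ M₂ e η ξ ξ₀ t ω + ξ t ω - ξ₀ t ω)) • e t ω := by
  rw [runEstimate, gradEstimate, increment]
  congr 2; ring

theorem step_bounds (hf : SmoothSetting ν μ₀ φ K L) (hφ : Measurable (Function.uncurry φ))
    (hμ : 0 < μ) (hμμ₀ : μ ≤ μ₀) (ho : OracleModel P ν δ e η ξ ξ₀) (hu : u ∈ simplex n) (t : ℕ) :
    (Measurable (iterate φ μ M₂ e η ξ ξ₀ t)) ∧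
    (Integrable (fun ω => inner ℝ (runEstimate φ μ M₂ e η ξ ξ₀ t ω)
      (iterate φ μ M₂ e η ξ ξ₀ t ω - u)) P ∧
    (∫ ω, objective ν φ (iterate φ μ M₂ e η ξ ξ₀ t ω) ∂P) - objective ν φ u -
      min (rms ν K * μ) (rms ν L / 2 * μ ^ 2) ≤
        ∫ ω, inner ℝ (runEstimate φ μ M₂ e η ξ ξ₀ t ω) (iterate φ μ M₂ e η ξ ξ₀ t ω - u) ∂P) ∧
    Integrable (fun ω => (n / μ * supNorm (e t ω) *
      (|increment φ μ M₂ e η ξ ξ₀ t ω| + 2 * δ)) ^ 2) P ∧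
    ∫ ω, (n / μ * supNorm (e t ω) * (|increment φ μ M₂ e η ξ ξ₀ t ω| + 2 * δ)) ^ 2 ∂P ≤
      n * supMoment n * (7 / 5 * rms ν K ^ 2 +
        7 * n * (rms ν L ^ 2 * μ ^ 2 / 4 + 4 * δ ^ 2 / μ ^ 2)) := by
  obtain ⟨Φ, hΦ, hS⟩ := exists_estimateSum_eq hφ μ M₂ e η ξ ξ₀ t
  let x : (Fin t → Vec n × H × ℝ × ℝ) → Vec n := fun p => mirror (stepParam M₂ (t + 1)) (Φ p)
  have hx : Measurable x := (measurable_mirror _).comp hΦ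
  have hxs : ∀ p, x p ∈ simplex n := fun p => mirror_mem_simplex _ _
  have hz := measurable_history ho t
  have hit : iterate φ μ M₂ e η ξ ξ₀ t = fun ω => x (history e η ξ ξ₀ t ω) := by
    ext1 ω
    simp only [x, iterate, hS]
  have hinc : increment φ μ M₂ e η ξ ξ₀ t = fun ω =>
      φ (x (history e η ξ ξ₀ t ω) + μ • e t ω) (η t ω) - φ (x (history e η ξ ξ₀ t ω)) (η t ω) := by
    ext1 ω
    simp only [increment, hit]
  have he := ho.measurable_direction t
  have hη := ho.measurable_realisation t
  obtain ⟨hv1, hv2⟩ := value_term hf hφ hμ hμμ₀ he hη hz (ho.law_direction t)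
    (ho.law_realisation t) (ho.indep_direction t) (ho.indep_realisation t) hx hxs hu
  obtain ⟨hn1, hn2⟩ := noise_term he (ho.law_direction t) hz (ho.measurable_noise t)
    (ho.indep_noise t) (ho.noise_le t) hx hxs hu
  obtain ⟨hm1, hm2⟩ := noise_term he (ho.law_direction t) hz (ho.measurable_noise₀ t)
    (ho.indep_noise₀ t) (ho.noise₀_le t) hx hxs hu
  -- Linearity separates increment, `ξ` and `ξ₀`, so each needs only its own independence from the
  -- direction; no joint independence is required.
  have hsplit : (fun ω => inner ℝ (runEstimate φ μ M₂ e η ξ ξ₀ t ω)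
      (iterate φ μ M₂ e η ξ ξ₀ t ω - u)) = fun ω => n / μ *
        ((φ (x (history e η ξ ξ₀ t ω) + μ • e t ω) (η t ω) -
          φ (x (history e η ξ ξ₀ t ω)) (η t ω)) * inner ℝ (e t ω) (x (history e η ξ ξ₀ t ω) - u) +
        ξ t ω * inner ℝ (e t ω) (x (history e η ξ ξ₀ t ω) - u) -
        ξ₀ t ω * inner ℝ (e t ω) (x (history e η ξ ξ₀ t ω) - u)) := by
    ext1 ω
    rw [runEstimate_eq, hinc, hit, real_inner_smul_left]
    ring
  refine ⟨hit ▸ hx.comp hz, ⟨?_, ?_⟩, ?_⟩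
  · rw [hsplit]
    exact ((hv1.add hn1).sub hm1).const_mul _
  · rw [hsplit, integral_const_mul, integral_sub (by exact hv1.add hn1) hm1, integral_add hv1 hn1, hn2, hm2,
      add_zero, sub_zero, hit]
    exact hv2
  · rw [hinc]
    exact second_moment_term hf hφ (delta_nonneg ho) hμ hμμ₀ he hη hz (ho.law_direction t)
      (ho.law_realisation t) (ho.indep_direction t) hx hxs

/-- The summand 2δ absorbs both noises, so the bound for ‖g^k‖_∞ depends only on direction, past and
realisation, and its second moment can be averaged over the direction. -/
theorem run_regret (hμ : 0 < μ) (hM : 0 < M₂) (ho : OracleModel P ν δ e η ξ ξ₀)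
    (hu : u ∈ simplex n) (N : ℕ) :
    ∀ᵐ ω ∂P, ∑ t ∈ Finset.range (N + 1), inner ℝ (runEstimate φ μ M₂ e η ξ ξ₀ t ω)
      (iterate φ μ M₂ e η ξ ξ₀ t ω - u) ≤ stepParam M₂ (N + 1) * Real.log n +
        ∑ t ∈ Finset.range (N + 1), (n / μ * supNorm (e t ω) *
          (|increment φ μ M₂ e η ξ ξ₀ t ω| + 2 * δ)) ^ 2 / (2 * stepParam M₂ (t + 1)) := by
  filter_upwards [ae_all_iff.2 ho.noise_le, ae_all_iff.2 ho.noise₀_le] with ω h1 h2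
  refine regret_le (fun t => estimateSum φ μ M₂ e η ξ ξ₀ ω t)
    (fun t => runEstimate φ μ M₂ e η ξ ξ₀ t ω) rfl (fun t => rfl)
    (fun t => stepParam M₂ (t + 1)) (fun t => n / μ * supNorm (e t ω) *
          (|increment φ μ M₂ e η ξ ξ₀ t ω| + 2 * δ)) (stepParam_pos hM) (stepParam_mono hM)
    (fun t i => ?_) hu N
  rw [runEstimate_eq, PiLp.smul_apply, smul_eq_mul, abs_mul, abs_mul, abs_of_nonneg
    (show (0 : ℝ) ≤ n / μ by positivity), mul_right_comm]
  have h3 : |increment φ μ M₂ e η ξ ξ₀ t ω + ξ t ω - ξ₀ t ω| ≤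
      |increment φ μ M₂ e η ξ ξ₀ t ω| + 2 * δ := by
    have h4 := abs_sub (increment φ μ M₂ e η ξ ξ₀ t ω + ξ t ω) (ξ₀ t ω)
    have h5 := abs_add_le (increment φ μ M₂ e η ξ ξ₀ t ω) (ξ t ω)
    linarith [h1 t, h2 t]
  have h6 := abs_apply_le_supNorm (e t ω) i
  have h7 := supNorm_nonneg (e t ω)
  gcongr

theorem expected_gap_le (hf : SmoothSetting ν μ₀ φ K L) (hφ : Measurable (Function.uncurry φ))
    (hn : 2 ≤ n) (hε : 0 < ε) (hM : M₂ = rms ν K) (hM0 : 0 < M₂) {L₂ : ℝ} (hL : L₂ = rms ν L)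
    (hL0 : 0 < L₂) (hμ : μ = smoothingRadius n ε M₂ L₂) (hμμ₀ : μ ≤ μ₀)
    (hδ : δ ≤ M₂ * μ / Real.sqrt (96 * n)) (ho : OracleModel P ν δ e η ξ ξ₀)
    (hu : u ∈ simplex n) :
    Integrable (fun ω => objective ν φ
      (average φ μ M₂ e η ξ ξ₀ (iterationCount n ε M₂) ω)) P ∧
    (∫ ω, objective ν φ (average φ μ M₂ e η ξ ξ₀ (iterationCount n ε M₂) ω) ∂P) -
      objective ν φ u ≤ ε := by
  have hμ0 : 0 < μ := hμ ▸ smoothingRadius_pos (by omega) hε hM0 hL0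
  have hb : min (M₂ * μ) (L₂ / 2 * μ ^ 2) ≤ ε / 2 := by
    subst hμ; exact bias_le hε hM0 hL0 hμ0
  have hc := second_moment_const_le hn hM0 hL0 (delta_nonneg ho) hμ0
    (hμ.le.trans (min_le_right _ _)) hδ
  have hstep := fun t => step_bounds (M₂ := M₂) hf hφ hμ0 hμμ₀ ho hu t
  simp only [← hM, ← hL] at hstep
  obtain ⟨N, hN⟩ := Nat.exists_eq_add_of_le' (iterationCount_pos hn hε hM0)
  have hN1 : (0 : ℝ) < (N + 1 : ℕ) := by positivity
  have hFi : ∀ t, Integrable (fun ω => objective ν φ (iterate φ μ M₂ e η ξ ξ₀ t ω)) P := fun t =>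
    integrable_objective_comp hf (hstep t).1 fun ω => iterate_mem_simplex φ t ω
  have havg : Measurable (average φ μ M₂ e η ξ ξ₀ (N + 1)) :=
    (Finset.measurable_sum _ fun t _ => (hstep t).1).const_smul (1 / ((N + 1 : ℕ) : ℝ))
  rw [hN]
  have hi : Integrable (fun ω => objective ν φ (average φ μ M₂ e η ξ ξ₀ (N + 1) ω)) P :=
    integrable_objective_comp hf havg fun ω => average_mem_simplex φ (Nat.succ_pos N) ω
  refine ⟨hi, ?_⟩
  have hjensen : ∫ ω, objective ν φ (average φ μ M₂ e η ξ ξ₀ (N + 1) ω) ∂P ≤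
      1 / (N + 1 : ℕ) * ∑ t ∈ Finset.range (N + 1),
        ∫ ω, objective ν φ (iterate φ μ M₂ e η ξ ξ₀ t ω) ∂P := by
    rw [← integral_finsetSum _ fun t _ => hFi t, ← integral_const_mul]
    exact integral_mono hi ((integrable_finsetSum _ fun t _ => hFi t).const_mul _)
      fun ω => objective_average_le hf (Nat.succ_pos N) ω
  have hregret : ∑ t ∈ Finset.range (N + 1), ∫ ω, inner ℝ (runEstimate φ μ M₂ e η ξ ξ₀ t ω)
      (iterate φ μ M₂ e η ξ ξ₀ t ω - u) ∂P ≤ stepParam M₂ (N + 1) * Real.log n +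
        ∑ t ∈ Finset.range (N + 1), 5 * M₂ ^ 2 * Real.log n / (2 * stepParam M₂ (t + 1)) := by
    have hG : ∀ t, Integrable (fun ω => (n / μ * supNorm (e t ω) *
          (|increment φ μ M₂ e η ξ ξ₀ t ω| + 2 * δ)) ^ 2 / (2 * stepParam M₂ (t + 1))) P :=
      fun t => (hstep t).2.2.1.div_const _
    rw [← integral_finsetSum _ fun t _ => (hstep t).2.1.1]
    refine (integral_mono_ae (integrable_finsetSum _ fun t _ => (hstep t).2.1.1)
      ((integrable_const _).add (integrable_finsetSum _ fun t _ => hG t))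
      (run_regret hμ0 hM0 ho hu N)).trans ?_
    simp only [Pi.add_apply]
    rw [integral_add (integrable_const _) (integrable_finsetSum _ fun t _ => hG t),
      integral_finsetSum _ fun t _ => hG t]
    simp only [integral_const, probReal_univ, one_smul]
    gcongr with t _
    rw [integral_div]
    have := stepParam_pos hM0 t
    gcongr
    exact (hstep t).2.2.2.trans hc
  have hrate := rate_le hn hε hM0 hN
  -- On the left, ε/2 per step pays for the smoothing bias; on the right, ε/2 per step is the
  -- expected regret.
  have hsum : ∑ t ∈ Finset.range (N + 1), ∫ ω, objective ν φ (iterate φ μ M₂ e η ξ ξ₀ t ω) ∂P -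
      (N + 1 : ℕ) * (objective ν φ u + ε / 2) ≤ (N + 1 : ℕ) * (ε / 2) := by
    refine le_trans ?_ (hregret.trans hrate)
    have h1 : ((N + 1 : ℕ) : ℝ) * (objective ν φ u + ε / 2) =
        ∑ _t ∈ Finset.range (N + 1), (objective ν φ u + ε / 2) := by simp [mul_add]
    rw [h1, ← Finset.sum_sub_distrib]
    refine Finset.sum_le_sum fun t _ => ?_
    linarith [(hstep t).2.1.2]
  have hfin : 1 / ((N + 1 : ℕ) : ℝ) * ∑ t ∈ Finset.range (N + 1),
      ∫ ω, objective ν φ (iterate φ μ M₂ e η ξ ξ₀ t ω) ∂P ≤ objective ν φ u + ε := by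
    rw [one_div, inv_mul_le_iff₀ hN1]
    linarith
  linarith

end Run

/-! ### Passing to a jointly measurable version -/

section Version

variable {n : ℕ} [NeZero n] {H Ω : Type*} [MeasurableSpace H] [MeasurableSpace Ω]
  {ν : Measure H} [IsProbabilityMeasure ν] {P : Measure Ω} [IsProbabilityMeasure P]
  {f g : Vec n → H → ℝ} {K L : H → ℝ} {μ₀ μ δ M₂ ε : ℝ}
  {e : ℕ → Ω → Vec n} {η : ℕ → Ω → H} {ξ ξ₀ : ℕ → Ω → ℝ}

theorem objective_congr (hfg : ∀ᵐ h ∂ν, ∀ x ∈ closedNhd n μ₀, g x h = f x h) {x : Vec n}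
    (hx : x ∈ closedNhd n μ₀) : objective ν g x = objective ν f x :=
  integral_congr_ae (hfg.mono fun _ hh => hh x hx)

theorem eventuallyEq_of_closedNhd {a b : Vec n → ℝ} (h : ∀ x ∈ closedNhd n μ₀, a x = b x)
    {x : Vec n} (hx : x ∈ openNhd n μ₀) : a =ᶠ[𝓝 x] b := by
  filter_upwards [isOpen_openNhd.mem_nhds hx] with y hy using h y (openNhd_subset_closedNhd hy)

theorem gradient_congr {a b : Vec n → ℝ} (h : ∀ x ∈ closedNhd n μ₀, a x = b x)
    {x : Vec n} (hx : x ∈ openNhd n μ₀) : gradient a x = gradient b x := by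
  rw [gradient, gradient, (eventuallyEq_of_closedNhd h hx).fderiv_eq]

theorem SmoothSetting.congr (hf : SmoothSetting ν μ₀ f K L)
    (hfg : ∀ᵐ h ∂ν, ∀ x ∈ closedNhd n μ₀, g x h = f x h) : SmoothSetting ν μ₀ g K L where
  integrable x hx := (hf.integrable x hx).congr (hfg.mono fun h hh => (hh x hx).symm)
  convex := by
    filter_upwards [hf.convex, hfg] with h h1 h2
    exact h1.congr fun x hx => (h2 x hx).symm
  gradient_expectation x hx := by
    have heq : (fun h => gradient (fun y => f y h) x) =ᵐ[ν] fun h => gradient (fun y => g y h) x :=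
      hfg.mono fun h hh => (gradient_congr hh hx).symm
    obtain ⟨h1, h2⟩ := hf.gradient_expectation x hx
    refine ⟨h1.congr heq, ?_⟩
    rw [← integral_congr_ae heq]
    exact h2.congr_of_eventuallyEq
      (eventuallyEq_of_closedNhd (fun y hy => objective_congr hfg hy) hx)
  lipschitz := by
    filter_upwards [hf.lipschitz, hfg] with h h1 h2 x hx y hy
    rw [h2 x hx, h2 y hy]; exact h1 x hx y hy
  lipschitz_memLp := hf.lipschitz_memLp
  differentiable := by
    filter_upwards [hf.differentiable, hfg] with h h1 h2 x hx
    exact (h1 x hx).congr_of_eventuallyEq (eventuallyEq_of_closedNhd h2 hx)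
  gradient_lipschitz := by
    filter_upwards [hf.gradient_lipschitz, hfg] with h h1 h2 x hx y hy
    rw [gradient_congr h2 hx, gradient_congr h2 hy]; exact h1 x hx y hy
  gradient_lipschitz_memLp := hf.gradient_lipschitz_memLp

/-- Almost surely all directions have norm 1, so every query stays in the closed neighbourhood,
where the two versions agree for every drawn realisation; the runs coincide by induction. -/
theorem estimateSum_congr (hfg : ∀ᵐ h ∂ν, ∀ x ∈ closedNhd n μ₀, g x h = f x h) (hμ : 0 < μ)
    (hμμ₀ : μ ≤ μ₀) (ho : OracleModel P ν δ e η ξ ξ₀) :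
    ∀ᵐ ω ∂P, ∀ t, estimateSum g μ M₂ e η ξ ξ₀ ω t = estimateSum f μ M₂ e η ξ ξ₀ ω t := by
  have h1 : ∀ᵐ ω ∂P, ∀ t, ∀ x ∈ closedNhd n μ₀, g x (η t ω) = f x (η t ω) :=
    ae_all_iff.2 fun t => ae_of_ae_map (ho.measurable_realisation t).aemeasurable
      ((ho.law_realisation t).symm ▸ hfg)
  have h2 : ∀ᵐ ω ∂P, ∀ t, ‖e t ω‖ = 1 :=
    ae_all_iff.2 fun t => ae_norm_direction (ho.measurable_direction t) (ho.law_direction t)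
  filter_upwards [h1, h2] with ω h1 h2 t
  induction t with
  | zero => rfl
  | succ t ih =>
    have hx := mirror_mem_simplex (stepParam M₂ (t + 1)) (estimateSum f μ M₂ e η ξ ξ₀ ω t)
    rw [estimateSum, estimateSum, ih, gradEstimate, gradEstimate,
      h1 t _ (SmoothConvex.smul_mem_closedNhd hμ hμμ₀ hx (h2 t).le),
      h1 t _ (simplex_subset_closedNhd hx)]

theorem average_congr (hfg : ∀ᵐ h ∂ν, ∀ x ∈ closedNhd n μ₀, g x h = f x h) (hμ : 0 < μ)
    (hμμ₀ : μ ≤ μ₀) (ho : OracleModel P ν δ e η ξ ξ₀) (N : ℕ) :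
    ∀ᵐ ω ∂P, average g μ M₂ e η ξ ξ₀ N ω = average f μ M₂ e η ξ ξ₀ N ω := by
  filter_upwards [estimateSum_congr (M₂ := M₂) hfg hμ hμμ₀ ho] with ω h
  simp only [average, iterate, h]

end Version

end GradientFree
end

theorem mainTheorem2 {n : ℕ} (hn : 2 ≤ n)
    {H : Type*} [MeasurableSpace H] (ν : Measure H) [IsProbabilityMeasure ν]
    {Ω : Type*} [MeasurableSpace Ω] (P : Measure Ω) [IsProbabilityMeasure P]
    (f : GradientFree.Vec n → H → ℝ) (K L : H → ℝ) (μ₀ ε δ M₂ L₂ μ : ℝ)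
    (hf : GradientFree.SmoothSetting ν μ₀ f K L)
    (hM₂ : M₂ = GradientFree.rms ν K) (hM₂pos : 0 < M₂)
    (hL₂ : L₂ = GradientFree.rms ν L) (hL₂pos : 0 < L₂)
    (hε : 0 < ε)
    (hμ : μ = GradientFree.smoothingRadius n ε M₂ L₂) (hμμ₀ : μ ≤ μ₀)
    (hδ : δ ≤ M₂ * μ / Real.sqrt (96 * n))
    (e : ℕ → Ω → GradientFree.Vec n) (η : ℕ → Ω → H) (ξ ξ₀ : ℕ → Ω → ℝ)
    (horacle : GradientFree.OracleModel P ν δ e η ξ ξ₀) :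
    Integrable (fun ω => GradientFree.objective ν f
      (GradientFree.average f μ M₂ e η ξ ξ₀ (GradientFree.iterationCount n ε M₂) ω)) P ∧
    ∃ fmin : ℝ, IsLeast (GradientFree.objective ν f '' GradientFree.simplex n) fmin ∧
      (∫ ω, GradientFree.objective ν f
        (GradientFree.average f μ M₂ e η ξ ξ₀ (GradientFree.iterationCount n ε M₂) ω) ∂P) - fmin
        ≤ ε := by
  have : NeZero n := ⟨by omega⟩
  have hμ0 : 0 < μ := hμ ▸ GradientFree.smoothingRadius_pos (by omega) hε hM₂pos hL₂pos
  -- The bound is proved for the run with `g`. Both runs have almost surely the same average, and it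
  -- lies in the simplex, where the two objectives agree.
  obtain ⟨g, hg, hfg⟩ := hf.exists_measurable
  have hcont := hf.objective_smoothConvex.continuousOn.mono
    (GradientFree.simplex_subset_closedNhd (n := n) (μ₀ := μ₀))
  obtain ⟨u, hu, hmin⟩ := GradientFree.isCompact_simplex.exists_isMinOn
    GradientFree.mem_simplex_nonempty hcont
  obtain ⟨hint, hgap⟩ := GradientFree.expected_gap_le (hf.congr hfg) hg hn hε hM₂ hM₂pos hL₂ hL₂pos
    hμ hμμ₀ hδ horacle hu
  have hpos := GradientFree.iterationCount_pos hn hε hM₂pos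
  have hae : (fun ω => GradientFree.objective ν g
      (GradientFree.average g μ M₂ e η ξ ξ₀ (GradientFree.iterationCount n ε M₂) ω)) =ᵐ[P]
      fun ω => GradientFree.objective ν f
      (GradientFree.average f μ M₂ e η ξ ξ₀ (GradientFree.iterationCount n ε M₂) ω) := by
    filter_upwards [GradientFree.average_congr (M₂ := M₂) hfg hμ0 hμμ₀ horacle
      (GradientFree.iterationCount n ε M₂)] with ω hω
    rw [hω]
    exact GradientFree.objective_congr hfg (GradientFree.simplex_subset_closedNhd
      (GradientFree.average_mem_simplex f hpos ω))
  refine ⟨hint.congr hae, GradientFree.objective ν f u, ⟨⟨u, hu, rfl⟩, ?_⟩, ?_⟩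
  · rintro _ ⟨y, hy, rfl⟩
    exact hmin hy
  · rw [← integral_congr_ae hae, ← GradientFree.objective_congr hfg
      (GradientFree.simplex_subset_closedNhd hu)]
    exact hgap
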